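/- Let $\Bbbk$ be a field of characteristic $0$, $\otimes=\otimes_{\Bbbk}$, let $A$ be a unital associative $\Bbbk$-algebra and $(e_s)_{s\in I}$ a finite complete family of orthogonal idempotents of $A$, $B=\bigoplus_{s\in I}\Bbbk e_s$. **Definitions.** A $B$-linear double bracket on $A$ is a $\Bbbk$-bilinear map $\{\!\{-,-\}\!\}:A\times A\to A\otimes A$ that vanishes when one argument lies in $B$ and satisfies $\{\!\{a,b\}\!\}=-\{\!\{b,a\}\!\}''\otimes\{\!\{b,a\}\!\}'$ and $\{\!\{a,bc\}\!\}=\{\!\{a,b\}\!\}c+b\{\!\{a,c\}\!\}$, where $b(x\otimes y)c=bx\otimes yc$. With $\tau(x\otimes y\otimes z)=z\otimes x\otimes y$, its triple bracket is $$\{\!\{a,b,c\}\!\}=\{\!\{a,\{\!\{b,c\}\!\}'\}\!\}\otimes\{\!\{b,c\}\!\}''+\tau\big(\{\!\{b,\{\!\{c,a\}\!\}'\}\!\}\otimes\{\!\{c,a\}\!\}''\big)+\tau^2\big(\{\!\{c,\{\!\{a,b\}\!\}'\}\!\}\otimes\{\!\{a,b\}\!\}''\big).$$ A double derivation of $A$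 over $B$ is a $\Bbbk$-linear map $\delta:A\to A\otimes A$ with $\delta(ab)=a\delta(b)+\delta(a)b$ and $\delta(B)=0$. Products of two or three double derivations define brackets by $$\{\!\{a,b\}\!\}_{\delta_1\delta_2}=\delta_2(b)'\delta_1(a)''\otimes\delta_1(a)'\delta_2(b)''-\delta_1(b)'\delta_2(a)''\otimes\delta_2(a)'\delta_1(b)'',$$ $$\{\!\{a,b,c\}\!\}_{\delta_1\delta_2\delta_3}=T(a,b,c)+\tau T(b,c,a)+\tau^2T(c,a,b),\quad T(a,b,c)=\delta_3(c)'\delta_1(a)''\otimes\delta_1(a)'\delta_2(b)''\otimes\delta_2(b)'\delta_3(c)''.$$ The gauge elements are $E_s(a)=ae_s\otimes e_s-e_s\otimes e_sa$. The pair $(A,\{\!\{-,-\}\!\})$ is a double quasi-Poisson algebra over $B$ if $\{\!\{-,-\}\!\}$ is a $B$-linear double bracket with $\{\!\{-,-,-\}\!\}=\frac1{12}\sum_{s\in I}\{\!\{-,-,-\}\!\}_{E_s^3}$. Let $1\neq2$ be two elements of $I$ and $\mu=1-e_1-e_2$. Put $$\bar A=A\ast_{\Bbbk e_1\oplus\Bbbk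 e_2\oplus\Bbbk\mu}\big(\mathrm{Mat}_2(\Bbbk)\oplus\Bbbk\mu\big),$$ where $e_1,e_2$ are identified with the diagonal matrix units and $e_{12},e_{21}$ denote the other two, put $\epsilon=1-e_2$, and let $A^f=\epsilon\bar A\epsilon$ be the fusion algebra obtained by fusing $e_2$ onto $e_1$, an algebra over $B^f=\bigoplus_{s\ne2}\Bbbk e_s$. A $B$-linear double bracket on $A$ (respectively, a double derivation of $A$ over $B$) extends uniquely to a double bracket on (double derivation of) $\bar A$ that is linear over (vanishes on) $\mathrm{Mat}_2(\Bbbk)\oplus\Bbbk\mu$. The bracket induced on $A^f$ is $\{\!\{x,y\}\!\}_{\mathrm{ind}}=(\epsilon\otimes\epsilon)\{\!\{x,y\}\!\}(\epsilon\otimes\epsilon)$, computed with the extended bracket on $\bar A$; for a double derivation $\delta$ of $A$ over $B$, with extension $\bar\delta$ to $\bar A$, $\mathrm{Tr}(\delta)$ is the double derivation of $A^f$ over $B^f$ given by $$\mathrm{Tr}(\delta)(x)=\epsilon\bar\delta(x)'\epsilon\otimes\epsilon\bar\delta(x)''\epsilon+\epsilon\bar\delta(x)'e_{21}\epsilon\otimes\epsilon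 e_{12}\bar\delta(x)''\epsilon .$$ **Theorem.** Let $(A,\{\!\{-,-\}\!\})$ be a double quasi-Poisson algebra over $B$. Then $A^f$, with $$\{\!\{-,-\}\!\}^f=\{\!\{-,-\}\!\}_{\mathrm{ind}}+\{\!\{-,-\}\!\}_{\mathrm{fus}},\qquad \{\!\{-,-\}\!\}_{\mathrm{fus}}=-\tfrac12\{\!\{-,-\}\!\}_{\mathrm{Tr}(E_1)\mathrm{Tr}(E_2)},$$ is a double quasi-Poisson algebra over $B^f$. -/

import Mathlib

open scoped TensorProduct

noncomputable section

namespace DoubleBrackets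

/-! ### Double and triple brackets, double derivations -/

section Brackets

variable {k : Type*} [Field k] {A : Type*} [Ring A] [Algebra k A]

/-- The outerAct bimodule action on `A ⊗ A`: `b (x ⊗ y) c = b x ⊗ y c`. -/
def outerAct (b c : A) : A ⊗[k] A →ₗ[k] A ⊗[k] A :=
  TensorProduct.map (LinearMap.mulLeft k b) (LinearMap.mulRight k c)

/-- The innerAct bimodule action on `A ⊗ A`: `b * (x ⊗ y) * c = x c ⊗ b y`. -/
def innerAct (b c : A) : A ⊗[k] A →ₗ[k] A ⊗[k] A :=
  TensorProduct.map (LinearMap.mulRight k c) (LinearMap.mulLeft k b)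

/-- `δ` is a double derivation of `A` relative to `B`, i.e. an element of `Der_B(A, A ⊗ A)` for the
outerAct bimodule structure. -/
structure IsDoubleDerivation (B : Subalgebra k A) (δ : A →ₗ[k] A ⊗[k] A) : Prop where
  leibniz : ∀ a b : A, δ (a * b) = outerAct a 1 (δ b) + outerAct 1 b (δ a)
  map_base : ∀ b ∈ B, δ b = 0

/-- `br` is a `B`-linear double bracket on `A`. -/
structure IsDoubleBracket (B : Subalgebra k A) (br : A →ₗ[k] A →ₗ[k] A ⊗[k] A) : Prop where
  antisymm : ∀ a b : A, br a b = -TensorProduct.comm k A A (br b a)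
  leibniz : ∀ a b c : A, br a (b * c) = outerAct 1 c (br a b) + outerAct b 1 (br a c)
  base_right : ∀ a : A, ∀ b ∈ B, br a b = 0
  base_left : ∀ b ∈ B, ∀ a : A, br b a = 0

/-- The cyclic permutation `x ⊗ y ⊗ z ↦ z ⊗ x ⊗ y` of `A ⊗ A ⊗ A`. -/
def cyc : (A ⊗[k] A) ⊗[k] A →ₗ[k] (A ⊗[k] A) ⊗[k] A :=
  (TensorProduct.assoc k A A A).symm.toLinearMap ∘ₗ
    (TensorProduct.comm k (A ⊗[k] A) A).toLinearMap

/-- The triple bracket associated with a double bracket: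
`⦃a, ⦃b,c⦄'⦄ ⊗ ⦃b,c⦄'' + τ (⦃b, ⦃c,a⦄'⦄ ⊗ ⦃c,a⦄'') + τ² (⦃c, ⦃a,b⦄'⦄ ⊗ ⦃a,b⦄'')`. -/
def tripleBracket (br : A →ₗ[k] A →ₗ[k] A ⊗[k] A) (a b c : A) : (A ⊗[k] A) ⊗[k] A :=
  (br a).rTensor A (br b c) + cyc ((br b).rTensor A (br c a)) +
    cyc (cyc ((br c).rTensor A (br a b)))

/-! ### Brackets defined by bivectors and trivectors -/

/-- The bilinear operation `(x₁ ⊗ y₁, x₂ ⊗ y₂) ↦ x₂ y₁ ⊗ x₁ y₂`. -/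
def contract₂ : A ⊗[k] A →ₗ[k] A ⊗[k] A →ₗ[k] A ⊗[k] A :=
  TensorProduct.homTensorHomMap (RingHom.id k) A A A A ∘ₗ
    TensorProduct.map (LinearMap.mul k A).flip (LinearMap.mul k A) ∘ₗ
      (TensorProduct.comm k A A).toLinearMap

theorem contract₂_tmul (x₁ y₁ x₂ y₂ : A) :
    contract₂ (k := k) (x₁ ⊗ₜ y₁) (x₂ ⊗ₜ y₂) = (x₂ * y₁) ⊗ₜ (x₁ * y₂) := by
  simp [contract₂]

/-- The linear operation `(x₁ ⊗ y₁) ⊗ (x₂ ⊗ y₂) ↦ y₁ ⊗ x₁ y₂ ⊗ x₂`. -/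
def chain : (A ⊗[k] A) ⊗[k] (A ⊗[k] A) →ₗ[k] (A ⊗[k] A) ⊗[k] A :=
  LinearMap.rTensor A (LinearMap.lTensor A (LinearMap.mul' k A)) ∘ₗ
    LinearMap.rTensor A (TensorProduct.assoc k A A A).toLinearMap ∘ₗ
      (TensorProduct.assoc k (A ⊗[k] A) A A).symm.toLinearMap ∘ₗ
        TensorProduct.map (TensorProduct.comm k A A).toLinearMap
          (TensorProduct.comm k A A).toLinearMap

/-- The outerAct action of `x ⊗ y` on `A ⊗ A ⊗ A`: `u ⊗ v ⊗ w ↦ x u ⊗ v ⊗ w y`. -/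
def outer₃ : A ⊗[k] A →ₗ[k] (A ⊗[k] A) ⊗[k] A →ₗ[k] (A ⊗[k] A) ⊗[k] A :=
  TensorProduct.homTensorHomMap (RingHom.id k) (A ⊗[k] A) A (A ⊗[k] A) A ∘ₗ
    TensorProduct.map (LinearMap.rTensorHom A ∘ₗ LinearMap.mul k A) (LinearMap.mul k A).flip

/-- The operation `(x₁ ⊗ y₁, x₂ ⊗ y₂, x₃ ⊗ y₃) ↦ x₃ y₁ ⊗ x₁ y₂ ⊗ x₂ y₃`, linear in each
argument. -/
def contract₃ (t₁ t₂ t₃ : A ⊗[k] A) : (A ⊗[k] A) ⊗[k] A :=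
  outer₃ t₃ (chain (t₁ ⊗ₜ t₂))

theorem contract₃_tmul (x₁ y₁ x₂ y₂ x₃ y₃ : A) :
    contract₃ (k := k) (x₁ ⊗ₜ y₁) (x₂ ⊗ₜ y₂) (x₃ ⊗ₜ y₃) =
      ((x₃ * y₁) ⊗ₜ (x₁ * y₂)) ⊗ₜ (x₂ * y₃) := by
  simp [contract₃, chain, outer₃]

/-- The double bracket defined by the bivector `δ₁ δ₂`:
`⦃a,b⦄ = δ₂(b)' δ₁(a)'' ⊗ δ₁(a)' δ₂(b)'' - δ₁(b)' δ₂(a)'' ⊗ δ₂(a)' δ₁(b)''`. -/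
def bivectorBracket (δ₁ δ₂ : A →ₗ[k] A ⊗[k] A) : A →ₗ[k] A →ₗ[k] A ⊗[k] A :=
  contract₂.compl₁₂ δ₁ δ₂ - contract₂.compl₁₂ δ₂ δ₁

/-- The triple bracket defined by the trivector `δ₁ δ₂ δ₃`: the sum over the cyclic group of order
three of `τ^i ∘ ⦃-,-,-⦄~ ∘ τ^(-i)`, where
`⦃a,b,c⦄~ = δ₃(c)' δ₁(a)'' ⊗ δ₁(a)' δ₂(b)'' ⊗ δ₂(b)' δ₃(c)''`. -/
def trivectorBracket (δ₁ δ₂ δ₃ : A →ₗ[k] A ⊗[k] A) (a b c : A) : (A ⊗[k] A) ⊗[k] A :=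
  contract₃ (δ₁ a) (δ₂ b) (δ₃ c) + cyc (contract₃ (δ₁ b) (δ₂ c) (δ₃ a)) +
    cyc (cyc (contract₃ (δ₁ c) (δ₂ a) (δ₃ b)))

/-! ### Gauge elements and double quasi-Poisson brackets -/

variable (k) in
/-- The gauge element attached to `e`: `a ↦ a e ⊗ e - e ⊗ e a`. -/
def gaugeElt (e : A) : A →ₗ[k] A ⊗[k] A :=
  (TensorProduct.mk k A A).flip e ∘ₗ LinearMap.mulRight k e -
    TensorProduct.mk k A A e ∘ₗ LinearMap.mulLeft k e

/-- `A` with the bracket `br` is a double quasi-Poisson algebra over `B = ⨁ k e_s`: the `e_s` form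
a complete family of orthogonal idempotents of `A`, `br` is a `B`-linear double bracket, and its
triple bracket is the one defined by `1/12 ∑ E_s³`, the `E_s` being the gauge elements. -/
structure IsDoubleQuasiPoisson {I : Type*} [Fintype I] (e : I → A)
    (br : A →ₗ[k] A →ₗ[k] A ⊗[k] A) : Prop where
  idem : CompleteOrthogonalIdempotents e
  bracket : IsDoubleBracket (Algebra.adjoin k (Set.range e)) br
  quasiPoisson : ∀ a b c : A, tripleBracket br a b c =
    (1 / 12 : k) • ∑ s, trivectorBracket (gaugeElt k (e s)) (gaugeElt k (e s)) (gaugeElt k (e s)) a b c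

end Brackets

section Actions

variable {k : Type*} [Field k] {P : Type*} [Ring P] [Algebra k P]

theorem outerAct_mul (x x' y y' : P) (t : P ⊗[k] P) :
    outerAct (x * x') (y' * y) t = outerAct x y (outerAct x' y' t) := by
  induction t with
  | zero => simp
  | tmul a b => simp [outerAct, mul_assoc]
  | add a b ha hb => simp [ha, hb]

theorem innerAct_mul (x x' y y' : P) (t : P ⊗[k] P) :
    innerAct (x * x') (y' * y) t = innerAct x y (innerAct x' y' t) := by
  induction t with
  | zero => simp
  | tmul a b => simp [innerAct, mul_assoc]
  | add a b ha hb => simp [ha, hb]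

theorem outerAct_innerAct (x x' y y' : P) (t : P ⊗[k] P) :
    outerAct x y (innerAct x' y' t) = innerAct x' y' (outerAct x y t) := by
  induction t with
  | zero => simp
  | tmul a b => simp [outerAct, innerAct, mul_assoc]
  | add a b ha hb => simp [ha, hb]

theorem comm_outerAct (x y : P) (t : P ⊗[k] P) :
    TensorProduct.comm k P P (outerAct x y t) = innerAct x y (TensorProduct.comm k P P t) := by
  induction t with
  | zero => simp
  | tmul a b => simp [outerAct, innerAct]
  | add a b ha hb => simp [ha, hb]

theorem comm_innerAct (x y : P) (t : P ⊗[k] P) :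
    TensorProduct.comm k P P (innerAct x y t) = outerAct x y (TensorProduct.comm k P P t) := by
  induction t with
  | zero => simp
  | tmul a b => simp [outerAct, innerAct]
  | add a b ha hb => simp [ha, hb]

theorem outerAct_one_one (t : P ⊗[k] P) : outerAct 1 1 t = t := by
  simp [outerAct]

theorem innerAct_one_one (t : P ⊗[k] P) : innerAct 1 1 t = t := by
  simp [innerAct]

variable (k P)

/-- `outerAct x 1` as a linear map in `x`. -/
def outerL : P →ₗ[k] Module.End k (P ⊗[k] P) where
  toFun x := outerAct x 1
  map_add' x y := by ext; simp [outerAct, add_mul, TensorProduct.add_tmul]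
  map_smul' c x := by ext; simp [outerAct, TensorProduct.smul_tmul']

/-- `outerAct 1 y` as a linear map in `y`. -/
def outerR : P →ₗ[k] Module.End k (P ⊗[k] P) where
  toFun y := outerAct 1 y
  map_add' x y := by ext; simp [outerAct, mul_add, TensorProduct.tmul_add]
  map_smul' c x := by ext; simp [outerAct]

/-- `innerAct x 1` as a linear map in `x`. -/
def innerL : P →ₗ[k] Module.End k (P ⊗[k] P) where
  toFun x := innerAct x 1
  map_add' x y := by ext; simp [innerAct, add_mul, TensorProduct.tmul_add]
  map_smul' c x := by ext; simp [innerAct]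

/-- `innerAct 1 y` as a linear map in `y`. -/
def innerR : P →ₗ[k] Module.End k (P ⊗[k] P) where
  toFun y := innerAct 1 y
  map_add' x y := by ext; simp [innerAct, mul_add, TensorProduct.add_tmul]
  map_smul' c x := by ext; simp [innerAct, TensorProduct.smul_tmul']

variable {Q : Type*} [Ring Q] [Algebra k Q]

variable {k P} in
theorem map_outerAct (f : Q →ₐ[k] P) (x y : Q) (t : Q ⊗[k] Q) :
    TensorProduct.map f.toLinearMap f.toLinearMap (outerAct x y t) =
      outerAct (f x) (f y) (TensorProduct.map f.toLinearMap f.toLinearMap t) := by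
  induction t with
  | zero => simp
  | tmul a b => simp [outerAct]
  | add a b ha hb => simp [ha, hb]

variable {k P} in
theorem map_innerAct (f : Q →ₐ[k] P) (x y : Q) (t : Q ⊗[k] Q) :
    TensorProduct.map f.toLinearMap f.toLinearMap (innerAct x y t) =
      innerAct (f x) (f y) (TensorProduct.map f.toLinearMap f.toLinearMap t) := by
  induction t with
  | zero => simp
  | tmul a b => simp [innerAct]
  | add a b ha hb => simp [ha, hb]

variable {k} in
/-- The derivation rule in the first argument. -/
theorem IsDoubleBracket.leibniz_left {B : Subalgebra k Q} {br : Q →ₗ[k] Q →ₗ[k] Q ⊗[k] Q}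
    (h : IsDoubleBracket B br) (a b c : Q) :
    br (a * b) c = innerAct 1 b (br a c) + innerAct a 1 (br b c) := by
  rw [h.antisymm (a * b) c, h.leibniz, h.antisymm a c, h.antisymm b c]
  simp only [map_add, comm_outerAct, map_neg]
  abel

end Actions

/-! ### Amalgamated products of algebras -/

section Amalgam

variable {k : Type*} [Field k] {C A A' : Type*} [Ring C] [Ring A] [Ring A']
  [Algebra k C] [Algebra k A] [Algebra k A']

/-- The relations defining `A *_C A'` as a quotient of the tensor algebra of `A ⊕ A'`. -/
inductive Amalg.Rel (j : C →ₐ[k] A) (j' : C →ₐ[k] A') :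
    TensorAlgebra k (A × A') → TensorAlgebra k (A × A') → Prop
  | one : Amalg.Rel j j' (TensorAlgebra.ι k (1, 0)) 1
  | mul_left (a b : A) : Amalg.Rel j j'
      (TensorAlgebra.ι k (a, 0) * TensorAlgebra.ι k (b, 0)) (TensorAlgebra.ι k (a * b, 0))
  | mul_right (a b : A') : Amalg.Rel j j'
      (TensorAlgebra.ι k (0, a) * TensorAlgebra.ι k (0, b)) (TensorAlgebra.ι k (0, a * b))
  | base (c : C) : Amalg.Rel j j' (TensorAlgebra.ι k (j c, 0)) (TensorAlgebra.ι k (0, j' c))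

/-- The free product `A *_C A'` of algebras amalgamated along `j : C → A` and `j' : C → A'`. -/
def Amalg (j : C →ₐ[k] A) (j' : C →ₐ[k] A') : Type _ := RingQuot (Amalg.Rel j j')

namespace Amalg

variable (j : C →ₐ[k] A) (j' : C →ₐ[k] A')

instance : Ring (Amalg j j') := inferInstanceAs (Ring (RingQuot (Amalg.Rel j j')))

instance : Algebra k (Amalg j j') := inferInstanceAs (Algebra k (RingQuot (Amalg.Rel j j')))

/-- The quotient map from the tensor algebra. -/
def mk : TensorAlgebra k (A × A') →ₐ[k] Amalg j j' := RingQuot.mkAlgHom k (Amalg.Rel j j')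

variable {j j'} in
theorem mk_rel {x y : TensorAlgebra k (A × A')} (h : Amalg.Rel j j' x y) :
    mk j j' x = mk j j' y :=
  RingQuot.mkAlgHom_rel k h

/-- The canonical map `A → A *_C A'`. -/
def inl : A →ₐ[k] Amalg j j' :=
  AlgHom.ofLinearMap
    ((mk j j').toLinearMap ∘ₗ TensorAlgebra.ι k ∘ₗ LinearMap.inl k A A')
    (by simpa using mk_rel (j := j) (j' := j') Rel.one)
    (fun a b ↦ by simpa using (mk_rel (j := j) (j' := j') (Rel.mul_left a b)).symm)

/-- The canonical map `A' → A *_C A'`. -/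
def inr : A' →ₐ[k] Amalg j j' :=
  AlgHom.ofLinearMap
    ((mk j j').toLinearMap ∘ₗ TensorAlgebra.ι k ∘ₗ LinearMap.inr k A A')
    (by
      have h := mk_rel (j := j) (j' := j') (Rel.base 1)
      have h' := mk_rel (j := j) (j' := j') Rel.one
      simp only [map_one] at h h'
      simpa using h.symm.trans h')
    (fun a b ↦ by simpa using (mk_rel (j := j) (j' := j') (Rel.mul_right a b)).symm)

theorem inl_base (c : C) : inl j j' (j c) = inr j j' (j' c) := by
  simpa [inl, inr] using mk_rel (j := j) (j' := j') (Rel.base c)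

variable {j j'} in
/-- `A *_C A'` is generated by the images of `A` and `A'`. -/
theorem induction {p : Amalg j j' → Prop} (hl : ∀ a, p (inl j j' a)) (hr : ∀ a, p (inr j j' a))
    (hadd : ∀ x y, p x → p y → p (x + y)) (hmul : ∀ x y, p x → p y → p (x * y))
    (x : Amalg j j') : p x := by
  obtain ⟨t, rfl⟩ : ∃ t, mk j j' t = x := RingQuot.mkAlgHom_surjective k _ x
  induction t using TensorAlgebra.induction with
  | algebraMap r =>
    have : mk j j' (algebraMap k _ r) = inl j j' (algebraMap k A r) := by
      simp only [AlgHom.commutes]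
    rw [this]; exact hl _
  | ι m =>
    have : mk j j' (TensorAlgebra.ι k m) = inl j j' m.1 + inr j j' m.2 := by
      obtain ⟨a, b⟩ := m
      simp [inl, inr, ← map_add]
    rw [this]; exact hadd _ _ (hl _) (hr _)
  | mul a b ha hb => rw [map_mul]; exact hmul _ _ ha hb
  | add a b ha hb => rw [map_add]; exact hadd _ _ ha hb

variable {j j'} in
/-- The universal property of `A *_C A'`. -/
theorem exists_lift {S : Type*} [Ring S] [Algebra k S] (f : A →ₐ[k] S) (g : A' →ₐ[k] S)
    (h : ∀ c, f (j c) = g (j' c)) :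
    ∃ F : Amalg j j' →ₐ[k] S, (∀ a, F (inl j j' a) = f a) ∧ ∀ a, F (inr j j' a) = g a := by
  let F₀ : TensorAlgebra k (A × A') →ₐ[k] S :=
    TensorAlgebra.lift k (f.toLinearMap.coprod g.toLinearMap)
  have hF₀ : ∀ ⦃x y⦄, Rel j j' x y → F₀ x = F₀ y := by
    rintro x y (_ | ⟨a, b⟩ | ⟨a, b⟩ | c) <;> simp [F₀, h]
  let F : Amalg j j' →ₐ[k] S := RingQuot.liftAlgHom k ⟨F₀, hF₀⟩
  have hF : ∀ t, F (mk j j' t) = F₀ t := fun t ↦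
    RingQuot.liftAlgHom_mkAlgHom_apply k F₀ hF₀ t
  refine ⟨F, fun a ↦ ?_, fun a ↦ ?_⟩
  · simpa [F₀, inl, inr] using hF (TensorAlgebra.ι k (a, 0))
  · simpa [F₀, inl, inr] using hF (TensorAlgebra.ι k (0, a))

variable {j j'} in
/-- A derivation of `A` into a bimodule `M` over `A *_C A'` (with commuting left and right actions
`L` and `R`) that vanishes on `C` extends uniquely to a derivation that vanishes on `A'`. -/
theorem existsUnique_derivation {M : Type*} [AddCommGroup M] [Module k M]
    (L R : Amalg j j' →ₗ[k] Module.End k M)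
    (hL1 : L 1 = 1) (hR1 : R 1 = 1) (hL : ∀ x y m, L (x * y) m = L x (L y m))
    (hR : ∀ x y m, R (x * y) m = R y (R x m)) (hLR : ∀ x y m, R y (L x m) = L x (R y m))
    (d : A →ₗ[k] M)
    (hd : ∀ a b, d (a * b) = L (inl j j' a) (d b) + R (inl j j' b) (d a))
    (hc : ∀ c, d (j c) = 0) :
    ∃! D : Amalg j j' →ₗ[k] M, (∀ x y, D (x * y) = L x (D y) + R y (D x)) ∧
      (∀ a, D (inl j j' a) = d a) ∧ ∀ a, D (inr j j' a) = 0 := by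
  have hd1 : d 1 = 0 := by simpa using hc 1
  let act (x : Amalg j j') (δ : M) : Module.End k (Amalg j j' × M) :=
    LinearMap.prod (LinearMap.mulLeft k x ∘ₗ LinearMap.fst k _ _)
      (L x ∘ₗ LinearMap.snd k _ _ + R.flip δ ∘ₗ LinearMap.fst k _ _)
  have act_apply : ∀ x δ p, act x δ p = (x * p.1, L x p.2 + R p.1 δ) := fun _ _ _ ↦ rfl
  let f : A →ₐ[k] Module.End k (Amalg j j' × M) :=
    AlgHom.ofLinearMap
      { toFun := fun a ↦ act (inl j j' a) (d a)
        map_add' := fun a b ↦ by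
          ext p <;> simp [act_apply, add_mul]
        map_smul' := fun c a ↦ by
          ext p <;> simp [act_apply] }
      (by ext p <;> simp [act_apply, hL1, hd1])
      (fun a b ↦ by
        ext p <;> simp [act_apply, hd, hL, hR, hLR, mul_assoc])
  let g : A' →ₐ[k] Module.End k (Amalg j j' × M) :=
    AlgHom.ofLinearMap
      { toFun := fun a ↦ act (inr j j' a) 0
        map_add' := fun a b ↦ by
          ext p <;> simp [act_apply, add_mul]
        map_smul' := fun c a ↦ by
          ext p <;> simp [act_apply] }
      (by ext p <;> simp [act_apply, hL1])
      (fun a b ↦ by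
        ext p <;> simp [act_apply, hL, mul_assoc])
  have hf : ∀ a, f a = act (inl j j' a) (d a) := fun _ ↦ rfl
  have hg : ∀ a, g a = act (inr j j' a) 0 := fun _ ↦ rfl
  obtain ⟨F, hFl, hFr⟩ := exists_lift (j := j) (j' := j') f g
    (fun c ↦ by rw [hf, hg, hc, inl_base])
  let D : Amalg j j' →ₗ[k] M :=
    LinearMap.snd k _ _ ∘ₗ F.toLinearMap.flip (1, 0)
  have hD : ∀ x, D x = (F x (1, 0)).2 := fun _ ↦ rfl
  have hDl : ∀ a, D (inl j j' a) = d a := fun a ↦ by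
    rw [hD, hFl, hf, act_apply]; simp [hR1]
  have hDr : ∀ a, D (inr j j' a) = 0 := fun a ↦ by
    rw [hD, hFr, hg, act_apply]; simp
  have key : ∀ x, F x = act x (D x) := by
    intro x
    induction x using Amalg.induction with
    | hl a => rw [hDl, hFl, hf]
    | hr a => rw [hDr, hFr, hg]
    | hadd x y hx hy =>
      rw [map_add, map_add, hx, hy]
      refine LinearMap.ext fun p ↦ ?_
      simp [act_apply, add_mul, add_add_add_comm]
    | hmul x y hx hy =>
      have : D (x * y) = L x (D y) + R y (D x) := by
        rw [hD, map_mul, hx, hy]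
        simp [act_apply, hR1]
      rw [map_mul, this, hx, hy]
      refine LinearMap.ext fun p ↦ ?_
      simp [act_apply, hL, hR, hLR, mul_assoc, add_assoc]
  refine ⟨D, ⟨fun x y ↦ ?_, hDl, hDr⟩, ?_⟩
  · rw [hD, map_mul, key x, key y]
    simp [act_apply, hR1]
  · rintro D' ⟨h1, h2, h3⟩
    refine LinearMap.ext fun x ↦ ?_
    induction x using Amalg.induction with
    | hl a => rw [h2, hDl]
    | hr a => rw [h3, hDr]
    | hadd x y hx hy => rw [map_add, map_add, hx, hy]
    | hmul x y hx hy =>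
      rw [h1, hx, hy, hD (x * y), map_mul, key x, key y]
      simp [act_apply, hR1]

variable {j j'} in
/-- A double derivation of `A` relative to `C` extends uniquely to a double derivation of
`A *_C A'` relative to `A'`. -/
theorem existsUnique_extDer {δ : A →ₗ[k] A ⊗[k] A} (hδ : IsDoubleDerivation j.range δ) :
    ∃! D : Amalg j j' →ₗ[k] Amalg j j' ⊗[k] Amalg j j',
      IsDoubleDerivation (inr j j').range D ∧
      ∀ a, D (inl j j' a) =
        TensorProduct.map (inl j j').toLinearMap (inl j j').toLinearMap (δ a) := by
  obtain ⟨D, ⟨h1, h2, h3⟩, h4⟩ := existsUnique_derivation (j := j) (j' := j')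
    (outerL k _) (outerR k _)
    (LinearMap.ext fun t ↦ outerAct_one_one t) (LinearMap.ext fun t ↦ outerAct_one_one t)
    (fun x y m ↦ by simpa [outerL] using outerAct_mul x y 1 1 m)
    (fun x y m ↦ by simpa [outerR] using outerAct_mul 1 1 y x m)
    (fun x y m ↦ by
      have e1 := outerAct_mul 1 x y 1 m
      have e2 := outerAct_mul x 1 1 y m
      simp only [one_mul, mul_one] at e1 e2
      exact e1.symm.trans e2)
    (TensorProduct.map (inl j j').toLinearMap (inl j j').toLinearMap ∘ₗ δ)
    (fun a b ↦ by
      simp [hδ.leibniz, map_outerAct, outerL, outerR])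
    (fun c ↦ by simp [hδ.map_base (j c) ⟨c, rfl⟩])
  refine ⟨D, ⟨⟨h1, ?_⟩, h2⟩, ?_⟩
  · rintro _ ⟨a, rfl⟩
    exact h3 a
  · rintro D' ⟨h5, h6⟩
    exact h4 D' ⟨h5.leibniz, h6, fun a ↦ h5.map_base _ ⟨a, rfl⟩⟩

variable {j j'} in
/-- A double bracket on `A` that is `C`-linear extends uniquely to a double bracket on `A *_C A'`
that is `A'`-linear. -/
theorem existsUnique_extBracket {br : A →ₗ[k] A →ₗ[k] A ⊗[k] A}
    (hbr : IsDoubleBracket j.range br) :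
    ∃! D : Amalg j j' →ₗ[k] Amalg j j' →ₗ[k] Amalg j j' ⊗[k] Amalg j j',
      IsDoubleBracket (inr j j').range D ∧
      ∀ a b, D (inl j j' a) (inl j j' b) =
        TensorProduct.map (inl j j').toLinearMap (inl j j').toLinearMap (br a b) := by
  have swap : ∀ (x y : Amalg j j') (m : Amalg j j' ⊗[k] Amalg j j'),
      outerAct 1 y (outerAct x 1 m) = outerAct x 1 (outerAct 1 y m) := fun x y m ↦ by
    have e1 := outerAct_mul 1 x y 1 m
    have e2 := outerAct_mul x 1 1 y m
    simp only [one_mul, mul_one] at e1 e2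
    exact e1.symm.trans e2
  have swap' : ∀ (x y : Amalg j j') (m : Amalg j j' ⊗[k] Amalg j j'),
      innerAct 1 y (innerAct x 1 m) = innerAct x 1 (innerAct 1 y m) := fun x y m ↦ by
    have e1 := innerAct_mul 1 x y 1 m
    have e2 := innerAct_mul x 1 1 y m
    simp only [one_mul, mul_one] at e1 e2
    exact e1.symm.trans e2
  let T := TensorProduct.map (inl j j').toLinearMap (inl j j').toLinearMap
  obtain ⟨G, ⟨g1, g2, g3⟩, -⟩ := existsUnique_derivation (j := j) (j' := j')
    (M := A →ₗ[k] Amalg j j' ⊗[k] Amalg j j')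
    (LinearMap.llcomp k A _ _ ∘ₗ outerL k _) (LinearMap.llcomp k A _ _ ∘ₗ outerR k _)
    (LinearMap.ext fun f ↦ LinearMap.ext fun a ↦ outerAct_one_one (f a))
    (LinearMap.ext fun f ↦ LinearMap.ext fun a ↦ outerAct_one_one (f a))
    (fun x y m ↦ LinearMap.ext fun a ↦ by simpa [outerL] using outerAct_mul x y 1 1 (m a))
    (fun x y m ↦ LinearMap.ext fun a ↦ by simpa [outerR] using outerAct_mul 1 1 y x (m a))
    (fun x y m ↦ LinearMap.ext fun a ↦ swap x y (m a))
    ((br.compr₂ T).flip)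
    (fun a b ↦ LinearMap.ext fun c ↦ by
      simp [hbr.leibniz, T, map_outerAct, outerL, outerR, add_comm])
    (fun c ↦ LinearMap.ext fun a ↦ by simp [hbr.base_right a (j c) ⟨c, rfl⟩])
  have g1' : ∀ x y a, G (x * y) a = outerAct x 1 (G y a) + outerAct 1 y (G x a) :=
    fun x y a ↦ LinearMap.congr_fun (g1 x y) a
  have g2' : ∀ b a, G (inl j j' b) a = T (br a b) := fun b a ↦ LinearMap.congr_fun (g2 b) a
  have g3' : ∀ b a, G (inr j j' b) a = 0 := fun b a ↦ LinearMap.congr_fun (g3 b) a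
  have g4 : ∀ y a b, G y (a * b) =
      innerAct (inl j j' a) 1 (G y b) + innerAct 1 (inl j j' b) (G y a) := by
    intro y a b
    induction y using Amalg.induction with
    | hl c => simp [g2', hbr.leibniz_left, T, map_innerAct, add_comm]
    | hr c => simp [g3']
    | hadd x y hx hy => simp only [map_add, LinearMap.add_apply, hx, hy]; abel
    | hmul x y hx hy => simp only [g1', hx, hy, map_add, outerAct_innerAct]; abel
  have g5 : ∀ y c, G y (j c) = 0 := by
    intro y c
    induction y using Amalg.induction with
    | hl b => simp [g2', hbr.base_left (j c) ⟨c, rfl⟩]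
    | hr b => simp [g3']
    | hadd x y hx hy => simp [hx, hy]
    | hmul x y hx hy => simp [g1', hx, hy]
  obtain ⟨H, ⟨h1, h2, h3⟩, -⟩ := existsUnique_derivation (j := j) (j' := j')
    (M := Amalg j j' →ₗ[k] Amalg j j' ⊗[k] Amalg j j')
    (LinearMap.llcomp k _ _ _ ∘ₗ innerL k _) (LinearMap.llcomp k _ _ _ ∘ₗ innerR k _)
    (LinearMap.ext fun f ↦ LinearMap.ext fun a ↦ innerAct_one_one (f a))
    (LinearMap.ext fun f ↦ LinearMap.ext fun a ↦ innerAct_one_one (f a))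
    (fun x y m ↦ LinearMap.ext fun a ↦ by simpa [innerL] using innerAct_mul x y 1 1 (m a))
    (fun x y m ↦ LinearMap.ext fun a ↦ by simpa [innerR] using innerAct_mul 1 1 y x (m a))
    (fun x y m ↦ LinearMap.ext fun a ↦ swap' x y (m a))
    G.flip
    (fun a b ↦ LinearMap.ext fun y ↦ g4 y a b)
    (fun c ↦ LinearMap.ext fun y ↦ g5 y c)
  have h1' : ∀ x y z, H (x * y) z = innerAct x 1 (H y z) + innerAct 1 y (H x z) :=
    fun x y z ↦ LinearMap.congr_fun (h1 x y) z
  have h2' : ∀ a y, H (inl j j' a) y = G y a := fun a y ↦ LinearMap.congr_fun (h2 a) y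
  have h3' : ∀ a y, H (inr j j' a) y = 0 := fun a y ↦ LinearMap.congr_fun (h3 a) y
  have h4 : ∀ x y z, H x (y * z) = outerAct 1 z (H x y) + outerAct y 1 (H x z) := by
    intro x y z
    induction x using Amalg.induction with
    | hl a => simp only [h2', g1', add_comm]
    | hr a => simp [h3']
    | hadd x x' hx hy => simp only [map_add, LinearMap.add_apply, hx, hy]; abel
    | hmul x x' hx hy => simp only [h1', hx, hy, map_add, outerAct_innerAct]; abel
  have h5 : ∀ x a, H x (inr j j' a) = 0 := by
    intro x a
    induction x using Amalg.induction with
    | hl b => rw [h2', g3']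
    | hr b => rw [h3']
    | hadd x y hx hy => simp [hx, hy]
    | hmul x y hx hy => simp [h1', hx, hy]
  have h6 : ∀ a b, H (inl j j' a) (inl j j' b) = T (br a b) := fun a b ↦ by rw [h2', g2']
  have hcomm : ∀ t : A ⊗[k] A, TensorProduct.comm k _ _ (T t) = T (TensorProduct.comm k A A t) := by
    intro t
    induction t with
    | zero => simp
    | tmul a b => simp [T]
    | add a b ha hb => simp [ha, hb]
  have h7 : ∀ x y, H x y = -TensorProduct.comm k _ _ (H y x) := by
    intro x
    induction x using Amalg.induction with
    | hl a =>
      intro y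
      induction y using Amalg.induction with
      | hl b => rw [h6, h6, hcomm, hbr.antisymm a b, map_neg]
      | hr b => rw [h5, h3']; simp
      | hadd x y hx hy => simp only [map_add, LinearMap.add_apply, hx, hy]; abel
      | hmul x y hx hy => simp only [h1', h4, hx, hy, map_add, map_neg, comm_innerAct]; abel
    | hr a => intro y; rw [h5, h3']; simp
    | hadd x x' hx hy => intro y; simp only [map_add, LinearMap.add_apply, hx, hy]; abel
    | hmul x x' hx hy =>
      intro y; simp only [h1', h4, hx, hy, map_add, map_neg, comm_outerAct]; abel
  refine ⟨H, ⟨⟨h7, h4, ?_, ?_⟩, h6⟩, ?_⟩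
  · rintro x _ ⟨a, rfl⟩
    exact h5 x a
  · rintro _ ⟨a, rfl⟩ y
    exact h3' a y
  · rintro D ⟨hD, hD'⟩
    refine LinearMap.ext fun x ↦ LinearMap.ext fun y ↦ ?_
    induction x using Amalg.induction with
    | hl a =>
      induction y using Amalg.induction with
      | hl b => rw [h6, hD']
      | hr b => rw [h5]; exact hD.base_right _ _ ⟨b, rfl⟩
      | hadd x y hx hy => simp only [map_add, hx, hy]
      | hmul x y hx hy => simp only [hD.leibniz, h4, hx, hy]
    | hr a => rw [h3']; exact hD.base_left _ ⟨a, rfl⟩ _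
    | hadd x x' hx hy => simp only [map_add, LinearMap.add_apply, hx, hy]
    | hmul x x' hx hy => simp only [hD.leibniz_left, h1', hx, hy, add_comm]

/-- The double derivation of `A *_C A'` relative to `A'` induced by a double derivation of `A`
relative to `C`. -/
def extDer (δ : A →ₗ[k] A ⊗[k] A) (hδ : IsDoubleDerivation j.range δ) :
    Amalg j j' →ₗ[k] Amalg j j' ⊗[k] Amalg j j' :=
  (existsUnique_extDer (j' := j') hδ).choose

/-- The `A'`-linear double bracket on `A *_C A'` induced by a `C`-linear double bracket on `A`. -/
def extBracket (br : A →ₗ[k] A →ₗ[k] A ⊗[k] A) (hbr : IsDoubleBracket j.range br) :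
    Amalg j j' →ₗ[k] Amalg j j' →ₗ[k] Amalg j j' ⊗[k] Amalg j j' :=
  (existsUnique_extBracket (j' := j') hbr).choose

end Amalg

end Amalgam

/-! ### Corner algebras -/

section Corner

variable {k : Type*} [Field k] {R : Type*} [Ring R] [Algebra k R] {ε : R}

instance cornerModule (hε : IsIdempotentElem ε) : Module k hε.Corner where
  smul c x := ⟨c • x.1, by obtain ⟨r, hr⟩ := x.2; exact ⟨c • r, by simp [← hr]⟩⟩
  one_smul x := Subtype.ext (one_smul k x.1)
  mul_smul c d x := Subtype.ext (mul_smul c d x.1)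
  smul_zero c := Subtype.ext (smul_zero c)
  smul_add c x y := Subtype.ext (smul_add c x.1 y.1)
  add_smul c d x := Subtype.ext (add_smul c d x.1)
  zero_smul x := Subtype.ext (zero_smul k x.1)

/-- `ε R ε` as a `k`-algebra with unit `ε`. -/
instance cornerAlgebra (hε : IsIdempotentElem ε) : Algebra k hε.Corner :=
  Algebra.ofModule
    (fun c x y ↦ Subtype.ext (smul_mul_assoc c x.1 y.1))
    (fun c x y ↦ Subtype.ext (mul_smul_comm c x.1 y.1))

variable (k) in
/-- The inclusion `ε R ε → R`. -/
def cornerIncl (hε : IsIdempotentElem ε) : hε.Corner →ₗ[k] R where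
  toFun x := x.1
  map_add' _ _ := rfl
  map_smul' _ _ := rfl

variable (k) in
/-- The projection `R → ε R ε`, `a ↦ ε a ε`. -/
def cornerProj (hε : IsIdempotentElem ε) : R →ₗ[k] hε.Corner where
  toFun a := ⟨ε * a * ε, a, rfl⟩
  map_add' a b := Subtype.ext (by simp [mul_add, add_mul]; rfl)
  map_smul' c a := Subtype.ext (by simp; rfl)

/-- The bracket induced on `ε R ε`: `⦃ε a ε, ε b ε⦄ = (ε ⊗ ε) ⦃a,b⦄ (ε ⊗ ε)`. -/
def cornerBracket (hε : IsIdempotentElem ε) (br : R →ₗ[k] R →ₗ[k] R ⊗[k] R) :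
    hε.Corner →ₗ[k] hε.Corner →ₗ[k] hε.Corner ⊗[k] hε.Corner :=
  (br.compl₁₂ (cornerIncl k hε) (cornerIncl k hε)).compr₂
    (TensorProduct.map (cornerProj k hε) (cornerProj k hε))

/-- For `p, q` in `R`, the map `ε a ε ↦ ε δ(a)' p ε ⊗ ε q δ(a)'' ε` on `ε R ε`, which is
`ε q δ p ε` for the inner bimodule structure on double derivations. -/
def cornerDer (hε : IsIdempotentElem ε) (q p : R) (δ : R →ₗ[k] R ⊗[k] R) :
    hε.Corner →ₗ[k] hε.Corner ⊗[k] hε.Corner :=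
  TensorProduct.map (cornerProj k hε) (cornerProj k hε) ∘ₗ innerAct q p ∘ₗ δ ∘ₗ cornerIncl k hε

end Corner

/-! ### Fusion -/

section Fusion

variable (k : Type*) [Field k] {A : Type*} [Ring A] [Algebra k A] {e₁ e₂ : A}

/-- `e₁, e₂` are orthogonal idempotents. -/
structure IsOrthogonalPair (e₁ e₂ : A) : Prop where
  idem₁ : e₁ * e₁ = e₁
  idem₂ : e₂ * e₂ = e₂
  ortho₁₂ : e₁ * e₂ = 0
  ortho₂₁ : e₂ * e₁ = 0

theorem _root_.CompleteOrthogonalIdempotents.isOrthogonalPair {I : Type*} [Fintype I] {e : I → A}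
    (he : CompleteOrthogonalIdempotents e) {i j : I} (hij : i ≠ j) :
    IsOrthogonalPair (e i) (e j) :=
  ⟨he.idem i, he.idem j, he.ortho hij, he.ortho hij.symm⟩

/-- The map `k e₁ ⊕ k e₂ ⊕ k μ → A`, `μ = 1 - e₁ - e₂`. -/
def baseToAlg (h : IsOrthogonalPair e₁ e₂) : (k × k × k) →ₐ[k] A :=
  AlgHom.ofLinearMap
    ((LinearMap.toSpanSingleton k A e₁).coprod
      ((LinearMap.toSpanSingleton k A e₂).coprod
        (LinearMap.toSpanSingleton k A (1 - e₁ - e₂))))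
    (by simp)
    (fun x y ↦ by
      simp [add_mul, mul_add, sub_mul, mul_sub, h.idem₁, h.idem₂, h.ortho₁₂, h.ortho₂₁, smul_smul,
        mul_comm])

/-- The map `k e₁ ⊕ k e₂ ⊕ k μ → Mat₂(k) ⊕ k μ`. -/
def baseToMat : (k × k × k) →ₐ[k] (Matrix (Fin 2) (Fin 2) k × k) :=
  ((Matrix.diagonalAlgHom k).comp
    (AlgHom.pi
      ![AlgHom.fst k k (k × k), (AlgHom.fst k k k).comp (AlgHom.snd k k (k × k))])).prod
    ((AlgHom.snd k k k).comp (AlgHom.snd k k (k × k)))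

/-- The extension algebra of `A` along `(e₁, e₂)`, that is
`A *_{k e₁ ⊕ k e₂ ⊕ k μ} (Mat₂(k) ⊕ k μ)`. -/
abbrev ExtAlg (h : IsOrthogonalPair e₁ e₂) : Type _ := Amalg (baseToAlg k h) (baseToMat k)

/-- The canonical map from `A` to its extension algebra. -/
def toExt (h : IsOrthogonalPair e₁ e₂) : A →ₐ[k] ExtAlg k h :=
  Amalg.inl (baseToAlg k h) (baseToMat k)

/-- The matrix unit `e_{st}` in the extension algebra (with indices in `{0, 1}`). -/
def matUnit (h : IsOrthogonalPair e₁ e₂) (s t : Fin 2) : ExtAlg k h :=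
  Amalg.inr (baseToAlg k h) (baseToMat k) (Matrix.single s t 1, 0)

theorem isIdempotentElem_eps (h : IsOrthogonalPair e₁ e₂) :
    IsIdempotentElem (1 - toExt k h e₂) :=
  IsIdempotentElem.one_sub (by
    unfold IsIdempotentElem
    rw [← map_mul, h.idem₂])

/-- The fusion algebra `ε Ā ε`, `ε = 1 - e₂`, obtained by fusing `e₂` onto `e₁`. -/
abbrev FusAlg (h : IsOrthogonalPair e₁ e₂) : Type _ := (isIdempotentElem_eps k h).Corner

/-- The image `ε a ε` in the fusion algebra of an element `a` of `A`. -/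
def toFus (h : IsOrthogonalPair e₁ e₂) (a : A) : FusAlg k h :=
  cornerProj k (isIdempotentElem_eps k h) (toExt k h a)

variable {k} in
/-- The double bracket on the fusion algebra induced by a double bracket on `A`. -/
def inducedBracket (h : IsOrthogonalPair e₁ e₂) (br : A →ₗ[k] A →ₗ[k] A ⊗[k] A)
    (hbr : IsDoubleBracket (baseToAlg k h).range br) :
    FusAlg k h →ₗ[k] FusAlg k h →ₗ[k] FusAlg k h ⊗[k] FusAlg k h :=
  cornerBracket (isIdempotentElem_eps k h)
    (Amalg.extBracket (baseToAlg k h) (baseToMat k) br hbr)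

variable {k} in
/-- The trace `Tr(δ) = ε δ ε + ε e₁₂ δ e₂₁ ε` on the fusion algebra of a double derivation of `A`,
which is first extended to the extension algebra. -/
def trDer (h : IsOrthogonalPair e₁ e₂) (δ : A →ₗ[k] A ⊗[k] A)
    (hδ : IsDoubleDerivation (baseToAlg k h).range δ) :
    FusAlg k h →ₗ[k] FusAlg k h ⊗[k] FusAlg k h :=
  cornerDer (isIdempotentElem_eps k h) 1 1
      (Amalg.extDer (baseToAlg k h) (baseToMat k) δ hδ) +
    cornerDer (isIdempotentElem_eps k h) (matUnit k h 0 1) (matUnit k h 1 0)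
      (Amalg.extDer (baseToAlg k h) (baseToMat k) δ hδ)

theorem gaugeElt_leibniz (e a b : A) :
    gaugeElt k e (a * b) = outerAct a 1 (gaugeElt k e b) + outerAct 1 b (gaugeElt k e a) := by
  simp [gaugeElt, outerAct, mul_assoc]

theorem isDoubleDerivation_gaugeElt₁ (h : IsOrthogonalPair e₁ e₂) :
    IsDoubleDerivation (baseToAlg k h).range (gaugeElt k e₁) where
  leibniz := gaugeElt_leibniz k e₁
  map_base := by
    rintro _ ⟨c, rfl⟩
    simp [baseToAlg, gaugeElt, mul_add, add_mul, sub_mul, mul_sub, h.idem₁, h.ortho₁₂, h.ortho₂₁]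

theorem isDoubleDerivation_gaugeElt₂ (h : IsOrthogonalPair e₁ e₂) :
    IsDoubleDerivation (baseToAlg k h).range (gaugeElt k e₂) where
  leibniz := gaugeElt_leibniz k e₂
  map_base := by
    rintro _ ⟨c, rfl⟩
    simp [baseToAlg, gaugeElt, mul_add, add_mul, sub_mul, mul_sub, h.idem₂, h.ortho₁₂, h.ortho₂₁]

/-- The double bracket `⦃-,-⦄_fus` on the fusion algebra, defined by the bivector
`-1/2 Tr(E₁) Tr(E₂)`. -/
def fusBracket (h : IsOrthogonalPair e₁ e₂) :
    FusAlg k h →ₗ[k] FusAlg k h →ₗ[k] FusAlg k h ⊗[k] FusAlg k h :=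
  (-(1 / 2) : k) • bivectorBracket
    (trDer h (gaugeElt k e₁) (isDoubleDerivation_gaugeElt₁ k h))
    (trDer h (gaugeElt k e₂) (isDoubleDerivation_gaugeElt₂ k h))

variable {k} in
/-- The subalgebra `k e₁ ⊕ k e₂ ⊕ k μ` lies in `B = ⨁ k e_s`, so `B`-linearity implies linearity
over it. -/
theorem IsDoubleQuasiPoisson.isDoubleBracket_base {I : Type*} [Fintype I] {e : I → A}
    {br : A →ₗ[k] A →ₗ[k] A ⊗[k] A} (hbr : IsDoubleQuasiPoisson e br) {i j : I} (hij : i ≠ j) :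
    IsDoubleBracket (baseToAlg k (hbr.idem.isOrthogonalPair hij)).range br := by
  have hle : (baseToAlg k (hbr.idem.isOrthogonalPair hij)).range ≤
      Algebra.adjoin k (Set.range e) := by
    rintro _ ⟨c, rfl⟩
    have hm : ∀ s, e s ∈ Algebra.adjoin k (Set.range e) := fun s ↦
      Algebra.subset_adjoin ⟨s, rfl⟩
    simp only [baseToAlg]
    refine add_mem (Subalgebra.smul_mem _ (hm i) _) (add_mem (Subalgebra.smul_mem _ (hm j) _)
      (Subalgebra.smul_mem _ (sub_mem (sub_mem (one_mem _) (hm i)) (hm j)) _))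
  exact ⟨hbr.bracket.antisymm, hbr.bracket.leibniz, fun a b hb ↦ hbr.bracket.base_right a b (hle hb),
    fun b hb a ↦ hbr.bracket.base_left b (hle hb) a⟩

end Fusion

end DoubleBrackets

end

/-!
Write `e₁₁ = e₁`, `e₂₂ = e₂` for the diagonal matrix units of the extension algebra `Ā`. The fused
bracket is the restriction to `ε Ā ε` of a bracket on all of `Ā`, namely the extension of the
bracket of `A` minus half of the bracket `P` defined by the bivector `E₁ (e₁₂ E₂ e₂₁)`. Triple and
trivector brackets are derivations in their last argument and cyclically invariant, so the
quasi-Poisson identity for it need only be verified on the image of `A`.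

There `E₁` and `e₁₂ E₂ e₂₁`, although not inner on `Ā`, coincide with the commutators with
`e₁₁ ⊗ e₁₁` and `e₂₁ ⊗ e₁₂`, so that `P` coincides with the inner bracket of
`ω = e₂₁ ⊗ e₁₂ - e₁₂ ⊗ e₂₁`. Since the matrix units are constants, the mixed terms between the inner
bracket of `ω` and any bracket on `Ā` linear over them cancel in the triple bracket. For the
extended bracket this leaves no mixed term; for `P` itself it makes the triple bracket of `P` the
negative of that of the inner bracket, which is the trivector of the Yang–Baxter element of `ω`.

On `ε Ā ε` the gauge element of `e₁` is the commutator with the Casimir element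
`e₁₁ ⊗ e₁₁ + e₂₁ ⊗ e₁₂`. Its cube exceeds the sum of the cubes of `e₁₁ ⊗ e₁₁` and `e₂₂ ⊗ e₂₂` by
exactly the Yang–Baxter element of `ω`, and the coefficients agree because `3 / 12 = (-1 / 2) ^ 2`.
-/

noncomputable section

namespace DoubleBrackets

section TensorCalculus

variable {k : Type*} [Field k] {R : Type*} [Ring R] [Algebra k R]

theorem outerAct_tmul (b c x y : R) :
    outerAct (k := k) b c (x ⊗ₜ y) = (b * x) ⊗ₜ (y * c) := rfl

theorem innerAct_tmul (b c x y : R) :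
    innerAct (k := k) b c (x ⊗ₜ y) = (x * c) ⊗ₜ (b * y) := rfl

theorem innerAct_zero_left (p : R) (t : R ⊗[k] R) : innerAct 0 p t = 0 := by
  simp [innerAct]

theorem cyc_tmul (x y z : R) : cyc (k := k) ((x ⊗ₜ y) ⊗ₜ z) = (z ⊗ₜ x) ⊗ₜ y := rfl

theorem chain_tmul (x₁ y₁ x₂ y₂ : R) :
    chain (k := k) ((x₁ ⊗ₜ y₁) ⊗ₜ (x₂ ⊗ₜ y₂)) = (y₁ ⊗ₜ (x₁ * y₂)) ⊗ₜ x₂ := by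
  simp [chain]

theorem outer₃_tmul (x y z : R) (w : R ⊗[k] R) :
    outer₃ (x ⊗ₜ y) (w ⊗ₜ z) = outerAct x 1 w ⊗ₜ (z * y) := by
  simp only [outer₃, outerAct, LinearMap.mulRight_one]
  rfl

theorem outer₃_tmul_tmul (x y a b c : R) :
    outer₃ (k := k) (x ⊗ₜ y) ((a ⊗ₜ b) ⊗ₜ c) = ((x * a) ⊗ₜ b) ⊗ₜ (c * y) := by
  rw [outer₃_tmul, outerAct_tmul, mul_one]

theorem cyc_cyc_cyc (t : (R ⊗[k] R) ⊗[k] R) : cyc (cyc (cyc t)) = t := by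
  have : (cyc ∘ₗ cyc ∘ₗ cyc : (R ⊗[k] R) ⊗[k] R →ₗ[k] _) = LinearMap.id := by
    ext x y z; rfl
  exact LinearMap.congr_fun this t

theorem outer₃_outerAct (x y : R) (u : R ⊗[k] R) (t : (R ⊗[k] R) ⊗[k] R) :
    outer₃ (outerAct x y u) t = outer₃ (x ⊗ₜ y) (outer₃ u t) := by
  have : outer₃ (k := k) ∘ₗ outerAct x y = outer₃.compr₂ (outer₃ (x ⊗ₜ y)) := by
    ext a b a' b' c'; simp [outer₃_tmul_tmul, outerAct_tmul, mul_assoc]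
  exact LinearMap.congr_fun₂ this u t

theorem comm_contract₂ (s t : R ⊗[k] R) :
    TensorProduct.comm k R R (contract₂ s t) = contract₂ t s := by
  have : contract₂.compr₂ (TensorProduct.comm k R R).toLinearMap = contract₂.flip := by
    ext a b c d; simp [contract₂_tmul]
  exact LinearMap.congr_fun₂ this s t

theorem contract₂_outerAct (s t : R ⊗[k] R) (x y : R) :
    contract₂ s (outerAct x y t) = outerAct x y (contract₂ s t) := by
  have : contract₂.compl₂ (outerAct x y) = contract₂.compr₂ (outerAct (k := k) x y) := by
    ext a b c d; simp [contract₂_tmul, outerAct_tmul, mul_assoc]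
  exact LinearMap.congr_fun₂ this s t

theorem contract₂_outerAct_left (s t : R ⊗[k] R) (x y : R) :
    contract₂ (outerAct x y s) t = innerAct x y (contract₂ s t) := by
  rw [← comm_contract₂, contract₂_outerAct, comm_outerAct, comm_contract₂]

theorem contract₃_outerAct (s t u : R ⊗[k] R) (x y : R) :
    contract₃ s t (outerAct x y u) = outer₃ (x ⊗ₜ y) (contract₃ s t u) :=
  outer₃_outerAct x y u _

theorem contract₃_add_left (s t u v : R ⊗[k] R) :
    contract₃ (s + t) u v = contract₃ s u v + contract₃ t u v := by
  simp [contract₃, TensorProduct.add_tmul]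

theorem contract₃_add_mid (s t u v : R ⊗[k] R) :
    contract₃ s (t + u) v = contract₃ s t v + contract₃ s u v := by
  simp [contract₃, TensorProduct.tmul_add]

theorem contract₃_add_right (s t u v : R ⊗[k] R) :
    contract₃ s t (u + v) = contract₃ s t u + contract₃ s t v := by
  simp [contract₃]

theorem cyc_contract₃ (t₁ t₂ t₃ : R ⊗[k] R) :
    cyc (contract₃ t₁ t₂ t₃) = contract₃ t₃ t₁ t₂ := by
  induction t₁ with
  | zero => simp [contract₃]
  | add x y hx hy => simp only [contract₃_add_left, contract₃_add_mid, map_add, hx, hy]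
  | tmul x₁ y₁ =>
  induction t₂ with
  | zero => simp [contract₃]
  | add x y hx hy => simp only [contract₃_add_mid, contract₃_add_right, map_add, hx, hy]
  | tmul x₂ y₂ =>
  induction t₃ with
  | zero => simp [contract₃]
  | add x y hx hy => simp only [contract₃_add_right, contract₃_add_left, map_add, hx, hy]
  | tmul x₃ y₃ => simp only [contract₃_tmul, cyc_tmul]

theorem trivectorBracket_eq (δ₁ δ₂ δ₃ : R →ₗ[k] R ⊗[k] R) (a b c : R) :
    trivectorBracket δ₁ δ₂ δ₃ a b c = contract₃ (δ₁ a) (δ₂ b) (δ₃ c) +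
      contract₃ (δ₂ a) (δ₃ b) (δ₁ c) + contract₃ (δ₃ a) (δ₁ b) (δ₂ c) := by
  simp only [trivectorBracket, cyc_contract₃]; abel

theorem bivectorBracket_apply (δ₁ δ₂ : R →ₗ[k] R ⊗[k] R) (a b : R) :
    bivectorBracket δ₁ δ₂ a b = contract₂ (δ₁ a) (δ₂ b) - contract₂ (δ₂ a) (δ₁ b) := rfl

end TensorCalculus

section DoubleDerivations

variable {k : Type*} [Field k] {R : Type*} [Ring R] [Algebra k R] {B : Subalgebra k R}
  {δ δ₁ δ₂ δ₃ : R →ₗ[k] R ⊗[k] R} {br br' : R →ₗ[k] R →ₗ[k] R ⊗[k] R}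

theorem IsDoubleDerivation.innerAct_comp (h : IsDoubleDerivation B δ) (q p : R) :
    IsDoubleDerivation B (innerAct q p ∘ₗ δ) where
  leibniz a b := by simp only [LinearMap.comp_apply, h.leibniz, map_add, outerAct_innerAct]
  map_base b hb := by simp [h.map_base b hb]

theorem IsDoubleBracket.isDoubleDerivation (h : IsDoubleBracket B br) (a : R) :
    IsDoubleDerivation B (br a) where
  leibniz b c := by rw [h.leibniz, add_comm]
  map_base := h.base_right a

theorem IsDoubleBracket.add (h : IsDoubleBracket B br) (h' : IsDoubleBracket B br') :
    IsDoubleBracket B (br + br') where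
  antisymm a b := by
    simp only [LinearMap.add_apply, map_add, h.antisymm a b, h'.antisymm a b]; abel
  leibniz a b c := by
    simp only [LinearMap.add_apply, map_add, h.leibniz, h'.leibniz]; abel
  base_right a b hb := by simp [h.base_right a b hb, h'.base_right a b hb]
  base_left b hb a := by simp [h.base_left b hb a, h'.base_left b hb a]

theorem IsDoubleBracket.smul (h : IsDoubleBracket B br) (r : k) :
    IsDoubleBracket B (r • br) where
  antisymm a b := by simp only [LinearMap.smul_apply, map_smul, h.antisymm a b, smul_neg]
  leibniz a b c := by simp only [LinearMap.smul_apply, map_smul, h.leibniz, smul_add]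
  base_right a b hb := by simp [h.base_right a b hb]
  base_left b hb a := by simp [h.base_left b hb a]

theorem isDoubleBracket_bivectorBracket (h₁ : IsDoubleDerivation B δ₁)
    (h₂ : IsDoubleDerivation B δ₂) : IsDoubleBracket B (bivectorBracket δ₁ δ₂) where
  antisymm a b := by simp only [bivectorBracket_apply, map_sub, comm_contract₂]; abel
  leibniz a b c := by
    simp only [bivectorBracket_apply, h₁.leibniz, h₂.leibniz, map_add, contract₂_outerAct, map_sub]
    abel
  base_right a b hb := by simp [bivectorBracket_apply, h₁.map_base b hb, h₂.map_base b hb]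
  base_left b hb a := by simp [bivectorBracket_apply, h₁.map_base b hb, h₂.map_base b hb]

theorem isDoubleBracket_adjoin {S : Set R}
    (antisymm : ∀ a b : R, br a b = -TensorProduct.comm k R R (br b a))
    (leibniz : ∀ a b c : R, br a (b * c) = outerAct 1 c (br a b) + outerAct b 1 (br a c))
    (base : ∀ a, ∀ s ∈ S, br a s = 0) : IsDoubleBracket (Algebra.adjoin k S) br := by
  have right (a b : R) (hb : b ∈ Algebra.adjoin k S) : br a b = 0 := by
    induction hb using Algebra.adjoin_induction with
    | mem x hx => exact base a x hx
    | algebraMap r =>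
      have := leibniz a 1 1
      rw [mul_one, outerAct_one_one, left_eq_add] at this
      rw [Algebra.algebraMap_eq_smul_one, map_smul, this, smul_zero]
    | add x y _ _ hx hy => rw [map_add, hx, hy, add_zero]
    | mul x y _ _ hx hy => simp [leibniz, hx, hy]
  exact ⟨antisymm, leibniz, right, fun b hb a ↦ by rw [antisymm, right a b hb]; simp⟩

end DoubleDerivations

/-! ### Triple and trivector brackets as cyclic derivations -/

section TripleDerivations

variable {k : Type*} [Field k] {R : Type*} [Ring R] [Algebra k R] {B : Subalgebra k R}

/-- The cyclically invariant operations `R × R × R → R ⊗ R ⊗ R` over `B`, by analogy with double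
brackets: derivations in the last argument, for the outer bimodule structure, that vanish on `B`.
Linearity is only recorded as additivity, which suffices to determine them on generators. -/
structure IsTripleDerivation (B : Subalgebra k R) (f : R → R → R → (R ⊗[k] R) ⊗[k] R) : Prop where
  add_right : ∀ a b c d, f a b (c + d) = f a b c + f a b d
  leibniz : ∀ a b c d, f a b (c * d) = outer₃ (1 ⊗ₜ d) (f a b c) + outer₃ (c ⊗ₜ 1) (f a b d)
  cyc_eq : ∀ a b c, f a b c = cyc (f b c a)
  base : ∀ a b, ∀ c ∈ B, f a b c = 0

theorem IsTripleDerivation.smul {f : R → R → R → (R ⊗[k] R) ⊗[k] R}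
    (hf : IsTripleDerivation B f) (r : k) : IsTripleDerivation B (fun a b c ↦ r • f a b c) where
  add_right a b c d := by simp only [hf.add_right, smul_add]
  leibniz a b c d := by simp only [hf.leibniz, map_smul, smul_add]
  cyc_eq a b c := by simp only [map_smul, ← hf.cyc_eq]
  base a b c hc := by simp [hf.base a b c hc]

theorem IsTripleDerivation.sum {ι : Type*} [Fintype ι]
    {f : ι → R → R → R → (R ⊗[k] R) ⊗[k] R} (hf : ∀ i, IsTripleDerivation B (f i)) :
    IsTripleDerivation B (fun a b c ↦ ∑ i, f i a b c) where
  add_right a b c d := by simp only [(hf _).add_right, Finset.sum_add_distrib]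
  leibniz a b c d := by simp only [(hf _).leibniz, map_sum, Finset.sum_add_distrib]
  cyc_eq a b c := by simp only [map_sum, ← (hf _).cyc_eq]
  base a b c hc := by simp [(hf _).base a b c hc]

theorem isTripleDerivation_trivectorBracket {δ₁ δ₂ δ₃ : R →ₗ[k] R ⊗[k] R}
    (h₁ : IsDoubleDerivation B δ₁) (h₂ : IsDoubleDerivation B δ₂) (h₃ : IsDoubleDerivation B δ₃) :
    IsTripleDerivation B (trivectorBracket δ₁ δ₂ δ₃) where
  add_right a b c d := by simp only [trivectorBracket_eq, map_add, contract₃_add_right]; abel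
  leibniz a b c d := by
    simp only [trivectorBracket_eq, h₁.leibniz, h₂.leibniz, h₃.leibniz, contract₃_add_right,
      contract₃_outerAct, map_add]
    abel
  cyc_eq a b c := by simp only [trivectorBracket, map_add, cyc_cyc_cyc]; abel
  base a b c hc := by
    simp [trivectorBracket_eq, contract₃, h₁.map_base c hc, h₂.map_base c hc, h₃.map_base c hc]

theorem cyc_tmul_mul (w : R ⊗[k] R) (x y : R) :
    cyc (w ⊗ₜ (x * y)) = outer₃ (x ⊗ₜ 1) (cyc (w ⊗ₜ y)) := by
  induction w with
  | zero => simp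
  | add u v hu hv => simp only [TensorProduct.add_tmul, map_add, hu, hv]
  | tmul a b => simp only [cyc_tmul, outer₃_tmul_tmul, mul_one]

theorem cyc_outerAct_tmul (w : R ⊗[k] R) (x y : R) :
    cyc (outerAct 1 x w ⊗ₜ y) = outer₃ (1 ⊗ₜ x) (cyc (w ⊗ₜ y)) := by
  induction w with
  | zero => simp
  | add u v hu hv => simp only [TensorProduct.add_tmul, map_add, hu, hv]
  | tmul a b => simp only [cyc_tmul, outerAct_tmul, outer₃_tmul_tmul, one_mul]

theorem cyc_cyc_innerAct_tmul (w : R ⊗[k] R) (x y z : R) :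
    cyc (cyc (innerAct x y w ⊗ₜ z)) = outer₃ (x ⊗ₜ y) (cyc (cyc (w ⊗ₜ z))) := by
  induction w with
  | zero => simp
  | add u v hu hv => simp only [TensorProduct.add_tmul, map_add, hu, hv]
  | tmul a b => simp only [cyc_tmul, innerAct_tmul, outer₃_tmul_tmul]

theorem rTensor_outerAct_right (g : R →ₗ[k] R ⊗[k] R) (d : R) (t : R ⊗[k] R) :
    g.rTensor R (outerAct 1 d t) = outer₃ (1 ⊗ₜ d) (g.rTensor R t) := by
  induction t with
  | zero => simp
  | add u v hu hv => simp only [map_add, hu, hv]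
  | tmul x y => simp [outerAct_tmul, outer₃_tmul, outerAct_one_one]

theorem cyc_rTensor_innerAct_left (g : R →ₗ[k] R ⊗[k] R) (c : R) (t : R ⊗[k] R) :
    cyc (g.rTensor R (innerAct c 1 t)) = outer₃ (c ⊗ₜ 1) (cyc (g.rTensor R t)) := by
  induction t with
  | zero => simp
  | add u v hu hv => simp only [map_add, hu, hv]
  | tmul x y => simp only [innerAct_tmul, LinearMap.rTensor_tmul, mul_one, cyc_tmul_mul]

theorem IsDoubleDerivation.rTensor_outerAct_left {δ : R →ₗ[k] R ⊗[k] R}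
    (h : IsDoubleDerivation B δ) (c : R) (t : R ⊗[k] R) :
    δ.rTensor R (outerAct c 1 t) =
      outer₃ (c ⊗ₜ 1) (δ.rTensor R t) + ((outerR k R).flip (δ c)).rTensor R t := by
  induction t with
  | zero => simp
  | add u v hu hv => simp only [map_add, hu, hv]; abel
  | tmul x y =>
    simp only [outerAct_tmul, LinearMap.rTensor_tmul, h.leibniz, outer₃_tmul, mul_one,
      TensorProduct.add_tmul]
    rfl

theorem IsDoubleDerivation.cyc_rTensor_innerAct_right {δ : R →ₗ[k] R ⊗[k] R}
    (h : IsDoubleDerivation B δ) (d : R) (t : R ⊗[k] R) :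
    cyc (δ.rTensor R (innerAct 1 d t)) =
      outer₃ (1 ⊗ₜ d) (cyc (δ.rTensor R t)) +
        cyc (((outerL k R).flip (δ d)).rTensor R t) := by
  induction t with
  | zero => simp
  | add u v hu hv => simp only [map_add, hu, hv]; abel
  | tmul x y =>
    simp only [innerAct_tmul, LinearMap.rTensor_tmul, h.leibniz, one_mul, TensorProduct.add_tmul,
      map_add, cyc_outerAct_tmul]
    rw [add_comm]
    rfl

theorem IsDoubleBracket.cyc_cyc_rTensor_mul {br : R →ₗ[k] R →ₗ[k] R ⊗[k] R}
    (h : IsDoubleBracket B br) (c d : R) (t : R ⊗[k] R) :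
    cyc (cyc ((br (c * d)).rTensor R t)) =
      outer₃ (1 ⊗ₜ d) (cyc (cyc ((br c).rTensor R t))) +
        outer₃ (c ⊗ₜ 1) (cyc (cyc ((br d).rTensor R t))) := by
  induction t with
  | zero => simp
  | add u v hu hv => simp only [map_add, hu, hv]; abel
  | tmul x y =>
    simp only [LinearMap.rTensor_tmul, h.leibniz_left, TensorProduct.add_tmul, map_add,
      cyc_cyc_innerAct_tmul]

theorem rTensor_outerR_comm (t w : R ⊗[k] R) :
    ((outerR k R).flip (TensorProduct.comm k R R t)).rTensor R w =
      cyc (((outerL k R).flip w).rTensor R t) := by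
  induction t with
  | zero => simp
  | add u v hu hv => simp only [map_add, LinearMap.rTensor_add, LinearMap.add_apply, hu, hv]
  | tmul a b =>
  induction w with
  | zero => simp
  | add u v hu hv =>
    simp only [map_add, LinearMap.rTensor_tmul, LinearMap.add_apply,
      TensorProduct.add_tmul] at hu hv ⊢
    rw [hu, hv]
  | tmul c d => simp [outerR, outerL, outerAct, cyc_tmul]

theorem IsDoubleBracket.tripleBracket_leibniz {br : R →ₗ[k] R →ₗ[k] R ⊗[k] R}
    (h : IsDoubleBracket B br) (a b c d : R) :
    tripleBracket br a b (c * d) =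
      outer₃ (1 ⊗ₜ d) (tripleBracket br a b c) + outer₃ (c ⊗ₜ 1) (tripleBracket br a b d) := by
  have defects_cancel : ((outerR k R).flip (br a c)).rTensor R (br b d) +
      cyc (((outerL k R).flip (br b d)).rTensor R (br c a)) = 0 := by
    rw [← rTensor_outerR_comm, h.antisymm a c, map_neg, LinearMap.rTensor_neg,
      LinearMap.neg_apply, neg_add_cancel]
  simp only [tripleBracket, h.leibniz b c d, h.leibniz_left c d a, map_add,
    rTensor_outerAct_right, (h.isDoubleDerivation a).rTensor_outerAct_left,
    (h.isDoubleDerivation b).cyc_rTensor_innerAct_right, cyc_rTensor_innerAct_left,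
    h.cyc_cyc_rTensor_mul, eq_neg_of_add_eq_zero_left defects_cancel]
  abel

theorem IsDoubleBracket.isTripleDerivation {br : R →ₗ[k] R →ₗ[k] R ⊗[k] R}
    (h : IsDoubleBracket B br) : IsTripleDerivation B (tripleBracket br) where
  add_right a b c d := by
    simp only [tripleBracket, map_add, LinearMap.add_apply, LinearMap.rTensor_add]; abel
  leibniz := h.tripleBracket_leibniz
  cyc_eq a b c := by simp only [tripleBracket, map_add, cyc_cyc_cyc]; abel
  base a b c hc := by
    have : br c = 0 := LinearMap.ext (h.base_left c hc)
    simp [tripleBracket, h.base_right b c hc, this]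

end TripleDerivations

/-! ### Inner double derivations and inner brackets -/

section InnerBrackets

variable {k : Type*} [Field k] {R : Type*} [Ring R] [Algebra k R]

/-- The bivector `p ∧ q = p ⊗ q - q ⊗ p`. -/
def wedge (p q : R) : R ⊗[k] R := p ⊗ₜ q - q ⊗ₜ p

variable (k R) in
/-- The inner double derivation `x ↦ x Δ - Δ x` defined by `Δ ∈ R ⊗ R`, for the outer bimodule
structure. -/
def innerDer (Δ : R ⊗[k] R) : R →ₗ[k] R ⊗[k] R :=
  (outerL k R).flip Δ - (outerR k R).flip Δ

variable (k R) in
/-- The inner bracket `(x, y) ↦ x ∗ [y, ω] - [y, ω] ∗ x` defined by `ω ∈ R ⊗ R`, where `[y, ω]` is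
the commutator for the outer bimodule structure and `∗` is the inner action. It is a derivation in
each argument, and satisfies the antisymmetry rule when `ω` does. -/
def innerBracket (ω : R ⊗[k] R) : R →ₗ[k] R →ₗ[k] R ⊗[k] R :=
  LinearMap.lcomp k (R ⊗[k] R) (innerDer k R ω) ∘ₗ (innerL k R - innerR k R)

/-- The commutator `t ↦ x t - t x` for the outer bimodule structure of `R ⊗ R ⊗ R`. -/
def adOuter (x : R) : Module.End k ((R ⊗[k] R) ⊗[k] R) := outer₃ (x ⊗ₜ 1 - 1 ⊗ₜ x)

/-- The composite of the commutators with `a`, `b` and `c` on `R ⊗ R ⊗ R`, each acting across a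
different pair of cyclically adjacent tensor factors: the analogue in three arguments of
`innerBracket`. -/
def innerTriple (a b c : R) : Module.End k ((R ⊗[k] R) ⊗[k] R) :=
  adOuter c ∘ₗ cyc ∘ₗ adOuter a ∘ₗ cyc ∘ₗ adOuter b ∘ₗ cyc

/-- The left-hand side of the associative Yang–Baxter equation for `ω`: the cyclic sum of
`ω₁'' ⊗ ω₁' ω₂'' ⊗ ω₂'`. -/
def yangBaxter (ω : R ⊗[k] R) : (R ⊗[k] R) ⊗[k] R :=
  chain (ω ⊗ₜ ω) + cyc (chain (ω ⊗ₜ ω)) + cyc (cyc (chain (ω ⊗ₜ ω)))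

theorem innerDer_apply (Δ : R ⊗[k] R) (x : R) :
    innerDer k R Δ x = outerAct x 1 Δ - outerAct 1 x Δ := rfl

theorem innerDer_leibniz (Δ : R ⊗[k] R) (x y : R) :
    innerDer k R Δ (x * y) =
      outerAct x 1 (innerDer k R Δ y) + outerAct 1 y (innerDer k R Δ x) := by
  have outerAct_comm : outerAct x 1 (outerAct 1 y Δ) = outerAct 1 y (outerAct x 1 Δ) := by
    simp only [← outerAct_mul, mul_one, one_mul]
  have mul_left := outerAct_mul x y 1 1 Δ
  have mul_right := outerAct_mul 1 1 y x Δ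
  rw [one_mul] at mul_left mul_right
  simp only [innerDer_apply, map_sub, mul_left, mul_right, outerAct_comm]
  abel

theorem innerDer_tmul_self (e : R) : innerDer k R (e ⊗ₜ e) = gaugeElt k e := by
  ext x; simp [innerDer_apply, outerAct_tmul, gaugeElt]

theorem innerAct_innerDer (x y : R) (Δ : R ⊗[k] R) (a : R) :
    innerAct x y (innerDer k R Δ a) = innerDer k R (innerAct x y Δ) a := by
  simp only [innerDer_apply, map_sub, outerAct_innerAct]

theorem innerBracket_apply (ω : R ⊗[k] R) (x y : R) :
    innerBracket k R ω x y =
      innerAct x 1 (innerDer k R ω y) - innerAct 1 x (innerDer k R ω y) := rfl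

theorem innerBracket_tmul (p q x y : R) :
    innerBracket k R (p ⊗ₜ q) x y = (y * p) ⊗ₜ (x * q) - p ⊗ₜ (x * (q * y)) -
      ((y * p * x) ⊗ₜ q - (p * x) ⊗ₜ (q * y)) := by
  simp only [innerBracket_apply, innerDer_apply, outerAct_tmul, innerAct_tmul, map_sub, mul_one,
    one_mul]

theorem innerBracket_sub (ω ω' : R ⊗[k] R) :
    innerBracket k R (ω - ω') = innerBracket k R ω - innerBracket k R ω' := by
  ext x y
  simp only [innerBracket_apply, innerDer_apply, map_sub, LinearMap.sub_apply]; abel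

theorem contract₂_innerDer (Δ₁ Δ₂ : R ⊗[k] R) (a b : R) :
    contract₂ (innerDer k R Δ₁ a) (innerDer k R Δ₂ b) =
      innerBracket k R (contract₂ Δ₁ Δ₂) a b := by
  simp only [innerBracket_apply, innerDer_apply, map_sub, LinearMap.sub_apply, contract₂_outerAct,
    contract₂_outerAct_left, outerAct_innerAct]
  abel

theorem adOuter_tmul (x a b c : R) :
    adOuter (k := k) x ((a ⊗ₜ b) ⊗ₜ c) = ((x * a) ⊗ₜ b) ⊗ₜ c - (a ⊗ₜ b) ⊗ₜ (c * x) := by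
  simp [adOuter, outer₃_tmul_tmul]

theorem contract₃_innerDer_right (t₁ t₂ Δ : R ⊗[k] R) (a : R) :
    contract₃ t₁ t₂ (innerDer k R Δ a) = adOuter a (contract₃ t₁ t₂ Δ) := by
  simp only [innerDer_apply, contract₃, adOuter, map_sub, LinearMap.sub_apply, outer₃_outerAct]

theorem contract₃_innerDer (Δ₁ Δ₂ Δ₃ : R ⊗[k] R) (a b c : R) :
    contract₃ (innerDer k R Δ₁ a) (innerDer k R Δ₂ b) (innerDer k R Δ₃ c) =
      innerTriple a b c (contract₃ Δ₁ Δ₂ Δ₃) := by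
  rw [contract₃_innerDer_right, ← cyc_contract₃, contract₃_innerDer_right, ← cyc_contract₃,
    contract₃_innerDer_right, ← cyc_contract₃]
  rfl

theorem trivectorBracket_innerDer (Δ : R ⊗[k] R) (a b c : R) :
    trivectorBracket (innerDer k R Δ) (innerDer k R Δ) (innerDer k R Δ) a b c =
      (3 : k) • innerTriple a b c (contract₃ Δ Δ Δ) := by
  rw [trivectorBracket_eq, contract₃_innerDer]
  module

theorem tripleBracket_innerBracket_wedge (p q a b c : R) :
    tripleBracket (innerBracket k R (wedge p q)) a b c =
      -innerTriple a b c (yangBaxter (wedge p q)) := by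
  simp only [tripleBracket, innerBracket_sub, wedge, LinearMap.sub_apply, innerBracket_tmul,
    map_sub, TensorProduct.tmul_sub, TensorProduct.sub_tmul, chain_tmul, cyc_tmul, innerTriple,
    LinearMap.comp_apply, adOuter_tmul, LinearMap.rTensor_tmul, LinearMap.rTensor_sub, map_add,
    mul_assoc, yangBaxter]
  abel

end InnerBrackets

section CrossBrackets

variable {k : Type*} [Field k] {R : Type*} [Ring R] [Algebra k R] {B : Subalgebra k R}
  {br br' : R →ₗ[k] R →ₗ[k] R ⊗[k] R}

/-- The polarization of the triple bracket, which is quadratic in the double bracket: `br` is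
applied to the first component of the values of `br'`. -/
def crossBracket (br br' : R →ₗ[k] R →ₗ[k] R ⊗[k] R) (a b c : R) : (R ⊗[k] R) ⊗[k] R :=
  (br a).rTensor R (br' b c) + cyc ((br b).rTensor R (br' c a)) +
    cyc (cyc ((br c).rTensor R (br' a b)))

theorem crossBracket_self (br : R →ₗ[k] R →ₗ[k] R ⊗[k] R) :
    crossBracket br br = tripleBracket br := rfl

theorem tripleBracket_add_smul (br br' : R →ₗ[k] R →ₗ[k] R ⊗[k] R) (r : k) (a b c : R) :
    tripleBracket (br + r • br') a b c = tripleBracket br a b c +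
      r • (crossBracket br br' a b c + crossBracket br' br a b c) +
        r ^ 2 • tripleBracket br' a b c := by
  simp only [tripleBracket, crossBracket, LinearMap.add_apply, LinearMap.smul_apply, map_add,
    map_smul, LinearMap.rTensor_add, LinearMap.rTensor_smul]
  module

theorem adOuter_outer₃_tmul (p q c : R) (t : R ⊗[k] R) :
    adOuter c (outer₃ (p ⊗ₜ q) (t ⊗ₜ 1)) =
      outerAct (c * p) 1 t ⊗ₜ q - outerAct p 1 t ⊗ₜ (q * c) := by
  simp [adOuter, outer₃_tmul, ← outerAct_mul]

theorem rTensor_innerBracket_wedge (p q c : R) (t : R ⊗[k] R) :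
    (innerBracket k R (wedge p q) c).rTensor R t =
      cyc (adOuter c (outer₃ (wedge p q) (t ⊗ₜ 1) - cyc (chain (t ⊗ₜ wedge p q)))) := by
  induction t with
  | zero => simp
  | add u v hu hv =>
    simp only [TensorProduct.add_tmul, map_add, map_sub, hu, hv]; abel
  | tmul x y =>
    simp only [wedge, innerBracket_sub, LinearMap.sub_apply, LinearMap.rTensor_tmul,
      innerBracket_tmul, TensorProduct.sub_tmul, TensorProduct.tmul_sub, map_sub, cyc_tmul,
      chain_tmul, outer₃_tmul_tmul, adOuter_tmul, mul_assoc, one_mul]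
    abel

theorem cyc_cyc_adOuter_cyc_chain (p q b : R) (t : R ⊗[k] R) :
    cyc (cyc (adOuter b (cyc (chain (t ⊗ₜ (q ⊗ₜ p)))))) =
      outerAct 1 p (TensorProduct.comm k R R t) ⊗ₜ (b * q) -
        outerAct 1 (p * b) (TensorProduct.comm k R R t) ⊗ₜ q := by
  induction t with
  | zero => simp
  | add u v hu hv => simp only [TensorProduct.add_tmul, map_add, hu, hv]; abel
  | tmul x y =>
    simp only [chain_tmul, cyc_tmul, adOuter_tmul, map_sub, TensorProduct.comm_tmul, outerAct_tmul,
      one_mul, mul_assoc]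

theorem IsDoubleBracket.rTensor_apply_innerBracket_tmul (h : IsDoubleBracket B br) {p : R}
    (hp : p ∈ B) (q a b c : R) :
    (br a).rTensor R (innerBracket k R (p ⊗ₜ q) b c) =
      -cyc (cyc (adOuter b (cyc (chain (br c a ⊗ₜ (q ⊗ₜ p)))))) -
        adOuter c (outer₃ (p ⊗ₜ q) (br a b ⊗ₜ 1)) := by
  simp only [innerBracket_tmul, map_sub, LinearMap.rTensor_tmul, h.leibniz, h.base_right a p hp,
    map_zero, add_zero, zero_add, h.antisymm a c, adOuter_outer₃_tmul, cyc_cyc_adOuter_cyc_chain,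
    map_neg, TensorProduct.neg_tmul, ← outerAct_mul, mul_one, TensorProduct.add_tmul,
    TensorProduct.zero_tmul, sub_zero]
  abel

theorem IsDoubleBracket.rTensor_apply_innerBracket_wedge (h : IsDoubleBracket B br) {p q : R}
    (hp : p ∈ B) (hq : q ∈ B) (a b c : R) :
    (br a).rTensor R (innerBracket k R (wedge p q) b c) =
      cyc (cyc (adOuter b (cyc (chain (br c a ⊗ₜ wedge p q))))) -
        adOuter c (outer₃ (wedge p q) (br a b ⊗ₜ 1)) := by
  simp only [wedge, innerBracket_sub, LinearMap.sub_apply, map_sub, TensorProduct.tmul_sub,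
    h.rTensor_apply_innerBracket_tmul hp, h.rTensor_apply_innerBracket_tmul hq]
  abel

theorem IsDoubleBracket.crossBracket_innerBracket_wedge (h : IsDoubleBracket B br) {p q : R}
    (hp : p ∈ B) (hq : q ∈ B) (a b c : R) :
    crossBracket br (innerBracket k R (wedge p q)) a b c +
      crossBracket (innerBracket k R (wedge p q)) br a b c = 0 := by
  simp only [crossBracket, h.rTensor_apply_innerBracket_wedge hp hq, rTensor_innerBracket_wedge,
    map_sub, cyc_cyc_cyc]
  abel

section Congr

variable {Q : Type*} [Ring Q] [Algebra k Q] {f : Q →ₗ[k] R}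
  {br₀ : Q →ₗ[k] Q →ₗ[k] Q ⊗[k] Q} {F : R →ₗ[k] R →ₗ[k] R ⊗[k] R}

theorem crossBracket_congr_right (hF : ∀ x y, br' (f x) (f y) = F (f x) (f y)) (a b c : Q) :
    crossBracket br br' (f a) (f b) (f c) = crossBracket br F (f a) (f b) (f c) := by
  simp only [crossBracket, hF]

theorem crossBracket_congr_left (hF : ∀ x y, br (f x) (f y) = F (f x) (f y))
    (hf : ∀ x y, br' (f x) (f y) = TensorProduct.map f f (br₀ x y)) (a b c : Q) :
    crossBracket br br' (f a) (f b) (f c) = crossBracket F br' (f a) (f b) (f c) := by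
  have rTensor_congr (x : Q) (t : Q ⊗[k] Q) :
      (br (f x)).rTensor R (TensorProduct.map f f t) =
        (F (f x)).rTensor R (TensorProduct.map f f t) := by
    induction t with
    | zero => simp
    | add u v hu hv => simp only [map_add, hu, hv]
    | tmul y z => simp only [TensorProduct.map_tmul, LinearMap.rTensor_tmul, hF]
  simp only [crossBracket, hf, rTensor_congr]

theorem IsDoubleBracket.tripleBracket_of_eq_innerBracket (h : IsDoubleBracket B br') {p q : R}
    (hp : p ∈ B) (hq : q ∈ B)
    (hF : ∀ x y, br' (f x) (f y) = innerBracket k R (wedge p q) (f x) (f y)) (a b c : Q) :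
    tripleBracket br' (f a) (f b) (f c) =
      innerTriple (f a) (f b) (f c) (yangBaxter (wedge p q)) := by
  rw [← crossBracket_self, crossBracket_congr_right hF,
    eq_neg_of_add_eq_zero_left (h.crossBracket_innerBracket_wedge hp hq _ _ _),
    crossBracket_congr_right hF, crossBracket_self, tripleBracket_innerBracket_wedge, neg_neg]

theorem IsDoubleBracket.tripleBracket_add_smul_of_eq_innerBracket (h : IsDoubleBracket B br)
    (h' : IsDoubleBracket B br') {p q : R} (hp : p ∈ B) (hq : q ∈ B)
    (hf : ∀ x y, br (f x) (f y) = TensorProduct.map f f (br₀ x y))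
    (hF : ∀ x y, br' (f x) (f y) = innerBracket k R (wedge p q) (f x) (f y)) (r : k)
    (a b c : Q) :
    tripleBracket (br + r • br') (f a) (f b) (f c) = tripleBracket br (f a) (f b) (f c) +
      r ^ 2 • innerTriple (f a) (f b) (f c) (yangBaxter (wedge p q)) := by
  rw [tripleBracket_add_smul, crossBracket_congr_right hF, crossBracket_congr_left hF hf,
    h.crossBracket_innerBracket_wedge hp hq, smul_zero, add_zero,
    h'.tripleBracket_of_eq_innerBracket hp hq hF]

end Congr

end CrossBrackets

section Naturality

variable {k : Type*} [Field k] {Q R : Type*} [Ring Q] [Algebra k Q] [Ring R] [Algebra k R]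

/-- The map `f ⊗ f ⊗ f` on third tensor powers. -/
def map₃ (f : Q →ₗ[k] R) : (Q ⊗[k] Q) ⊗[k] Q →ₗ[k] (R ⊗[k] R) ⊗[k] R :=
  TensorProduct.map (TensorProduct.map f f) f

theorem map₃_cyc (f : Q →ₗ[k] R) (t : (Q ⊗[k] Q) ⊗[k] Q) :
    map₃ f (cyc t) = cyc (map₃ f t) := by
  have : map₃ f ∘ₗ cyc = cyc ∘ₗ map₃ f := by ext x y z; rfl
  exact LinearMap.congr_fun this t

theorem map₃_tripleBracket (f : Q →ₗ[k] R) {br : Q →ₗ[k] Q →ₗ[k] Q ⊗[k] Q}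
    {br' : R →ₗ[k] R →ₗ[k] R ⊗[k] R}
    (h : ∀ x y, TensorProduct.map f f (br x y) = br' (f x) (f y)) (a b c : Q) :
    map₃ f (tripleBracket br a b c) = tripleBracket br' (f a) (f b) (f c) := by
  have map₃_rTensor (x : Q) (t : Q ⊗[k] Q) :
      map₃ f ((br x).rTensor Q t) = (br' (f x)).rTensor R (TensorProduct.map f f t) := by
    induction t with
    | zero => simp
    | add u v hu hv => simp only [map_add, hu, hv]
    | tmul y z => simp [map₃, h]
  simp only [tripleBracket, map_add, map₃_cyc, map₃_rTensor, h]

variable (f : Q →ₗ[k] R) (hf : ∀ x y, f (x * y) = f x * f y)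
include hf

theorem map_contract₂ (s t : Q ⊗[k] Q) :
    TensorProduct.map f f (contract₂ s t) =
      contract₂ (TensorProduct.map f f s) (TensorProduct.map f f t) := by
  have : contract₂.compr₂ (TensorProduct.map f f) =
      contract₂.compl₁₂ (TensorProduct.map f f) (TensorProduct.map f f) := by
    ext a b c d; simp [contract₂_tmul, hf]
  exact LinearMap.congr_fun₂ this s t

theorem map₃_contract₃ (s t u : Q ⊗[k] Q) :
    map₃ f (contract₃ s t u) = contract₃ (TensorProduct.map f f s) (TensorProduct.map f f t)
      (TensorProduct.map f f u) := by
  have map₃_chain : map₃ f ∘ₗ chain =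
      chain ∘ₗ TensorProduct.map (TensorProduct.map f f) (TensorProduct.map f f) := by
    ext a b c d; simp [chain_tmul, map₃, hf]
  have map₃_outer₃ : outer₃.compr₂ (map₃ f) =
      outer₃.compl₁₂ (TensorProduct.map f f) (map₃ f) := by
    ext x y a b c; simp [outer₃_tmul_tmul, map₃, hf]
  calc map₃ f (outer₃ u (chain (s ⊗ₜ t)))
    _ = outer₃ (TensorProduct.map f f u) (map₃ f (chain (s ⊗ₜ t))) :=
      LinearMap.congr_fun₂ map₃_outer₃ u _
    _ = _ := congrArg _ (LinearMap.congr_fun map₃_chain (s ⊗ₜ t))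

theorem map_outerAct_left (x : Q) (t : Q ⊗[k] Q) :
    TensorProduct.map f f (outerAct x 1 t) = outerAct (f x) 1 (TensorProduct.map f f t) := by
  have : TensorProduct.map f f ∘ₗ outerAct x 1 = outerAct (f x) 1 ∘ₗ TensorProduct.map f f := by
    ext a b; simp [outerAct_tmul, hf]
  exact LinearMap.congr_fun this t

theorem map_outerAct_right (x : Q) (t : Q ⊗[k] Q) :
    TensorProduct.map f f (outerAct 1 x t) = outerAct 1 (f x) (TensorProduct.map f f t) := by
  have : TensorProduct.map f f ∘ₗ outerAct 1 x = outerAct 1 (f x) ∘ₗ TensorProduct.map f f := by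
    ext a b; simp [outerAct_tmul, hf]
  exact LinearMap.congr_fun this t

theorem isDoubleBracket_adjoin_of_injective {B : Subalgebra k R}
    (hinj : Function.Injective (TensorProduct.map f f)) {br : Q →ₗ[k] Q →ₗ[k] Q ⊗[k] Q}
    {br' : R →ₗ[k] R →ₗ[k] R ⊗[k] R} (hbr' : IsDoubleBracket B br')
    (hbr : ∀ x y, TensorProduct.map f f (br x y) = br' (f x) (f y))
    {S : Set Q} (hS : ∀ x, ∀ s ∈ S, br' (f x) (f s) = 0) :
    IsDoubleBracket (Algebra.adjoin k S) br := by
  refine isDoubleBracket_adjoin (fun a b ↦ hinj ?antisymm) (fun a b c ↦ hinj ?leibniz)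
    (fun a s hs ↦ hinj ?base)
  case antisymm => rw [map_neg, TensorProduct.map_comm, hbr, hbr, hbr'.antisymm]
  case leibniz =>
    rw [map_add, map_outerAct_left f hf, map_outerAct_right f hf, hbr, hbr, hbr, hf, hbr'.leibniz]
  case base => rw [hbr, hS _ s hs, map_zero]

theorem map₃_trivectorBracket {δ : Q →ₗ[k] Q ⊗[k] Q} {δ' : R →ₗ[k] R ⊗[k] R}
    (h : ∀ x, TensorProduct.map f f (δ x) = δ' (f x)) (a b c : Q) :
    map₃ f (trivectorBracket δ δ δ a b c) = trivectorBracket δ' δ' δ' (f a) (f b) (f c) := by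
  simp only [trivectorBracket_eq, map_add, map₃_contract₃ f hf, h]

theorem map_gaugeElt (e x : Q) :
    TensorProduct.map f f (gaugeElt k e x) = gaugeElt k (f e) (f x) := by
  simp [gaugeElt, hf]

end Naturality

/-! ### Extensions to amalgamated products -/

namespace Amalg

variable {k : Type*} [Field k] {C A A' : Type*} [Ring C] [Ring A] [Ring A']
  [Algebra k C] [Algebra k A] [Algebra k A'] {j : C →ₐ[k] A} {j' : C →ₐ[k] A'}

theorem isTripleDerivation_ext
    {f g : Amalg j j' → Amalg j j' → Amalg j j' → (Amalg j j' ⊗[k] Amalg j j') ⊗[k] Amalg j j'}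
    (hf : IsTripleDerivation (inr j j').range f) (hg : IsTripleDerivation (inr j j').range g)
    (h : ∀ a b c, f (inl j j' a) (inl j j' b) (inl j j' c) =
      g (inl j j' a) (inl j j' b) (inl j j' c)) (x y z : Amalg j j') :
    f x y z = g x y z := by
  have ext_last (x y : Amalg j j') (h : ∀ c, f x y (inl j j' c) = g x y (inl j j' c))
      (z : Amalg j j') : f x y z = g x y z := by
    induction z using Amalg.induction with
    | hl a => exact h a
    | hr a => exact (hf.base _ _ _ ⟨a, rfl⟩).trans (hg.base _ _ _ ⟨a, rfl⟩).symm
    | hadd z w hz hw => rw [hf.add_right, hg.add_right, hz, hw]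
    | hmul z w hz hw => rw [hf.leibniz, hg.leibniz, hz, hw]
  have ext_two (a z y) : f z (inl j j' a) y = g z (inl j j' a) y :=
    ext_last _ _ (fun b ↦ by rw [hf.cyc_eq, hg.cyc_eq, ext_last _ _ (h a b)]) y
  exact ext_last _ _ (fun a ↦ by rw [hf.cyc_eq, hg.cyc_eq, ext_two]) z

theorem isDoubleDerivation_ext {δ δ' : Amalg j j' →ₗ[k] Amalg j j' ⊗[k] Amalg j j'}
    (h : IsDoubleDerivation (inr j j').range δ) (h' : IsDoubleDerivation (inr j j').range δ')
    (hl : ∀ a, δ (inl j j' a) = δ' (inl j j' a)) : δ = δ' := by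
  refine LinearMap.ext fun x ↦ ?_
  induction x using Amalg.induction with
  | hl a => exact hl a
  | hr a => exact (h.map_base _ ⟨a, rfl⟩).trans (h'.map_base _ ⟨a, rfl⟩).symm
  | hadd x y hx hy => rw [map_add, map_add, hx, hy]
  | hmul x y hx hy => rw [h.leibniz, h'.leibniz, hx, hy]

theorem isDoubleDerivation_extDer {δ : A →ₗ[k] A ⊗[k] A} (hδ : IsDoubleDerivation j.range δ) :
    IsDoubleDerivation (inr j j').range (extDer j j' δ hδ) :=
  (existsUnique_extDer hδ).choose_spec.1.1

theorem extDer_inl {δ : A →ₗ[k] A ⊗[k] A} (hδ : IsDoubleDerivation j.range δ) (a : A) :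
    extDer j j' δ hδ (inl j j' a) =
      TensorProduct.map (inl j j').toLinearMap (inl j j').toLinearMap (δ a) :=
  (existsUnique_extDer hδ).choose_spec.1.2 a

theorem isDoubleBracket_extBracket {br : A →ₗ[k] A →ₗ[k] A ⊗[k] A}
    (hbr : IsDoubleBracket j.range br) :
    IsDoubleBracket (inr j j').range (extBracket j j' br hbr) :=
  (existsUnique_extBracket hbr).choose_spec.1.1

theorem extBracket_inl {br : A →ₗ[k] A →ₗ[k] A ⊗[k] A} (hbr : IsDoubleBracket j.range br)
    (a b : A) : extBracket j j' br hbr (inl j j' a) (inl j j' b) =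
      TensorProduct.map (inl j j').toLinearMap (inl j j').toLinearMap (br a b) :=
  (existsUnique_extBracket hbr).choose_spec.1.2 a b

theorem apply_inl_eq_zero {br : Amalg j j' →ₗ[k] Amalg j j' →ₗ[k] Amalg j j' ⊗[k] Amalg j j'}
    (hbr : IsDoubleBracket (inr j j').range br) {b : A}
    (hb : ∀ a, br (inl j j' b) (inl j j' a) = 0) (x : Amalg j j') : br x (inl j j' b) = 0 := by
  suffices br (inl j j' b) = 0 by simp [hbr.antisymm x, this]
  exact isDoubleDerivation_ext (hbr.isDoubleDerivation _)
    ⟨fun x y ↦ by simp, fun _ _ ↦ rfl⟩ hb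

section Gauge

variable {e : A} (hδ : IsDoubleDerivation j.range (gaugeElt k e))

theorem extDer_gaugeElt_inl (a : A) :
    extDer j j' (gaugeElt k e) hδ (inl j j' a) =
      innerDer k (Amalg j j') (inl j j' e ⊗ₜ inl j j' e) (inl j j' a) := by
  rw [extDer_inl, innerDer_tmul_self]
  exact map_gaugeElt (inl j j').toLinearMap (map_mul (inl j j')) e a

theorem innerAct_extDer_gaugeElt (he : e * e = e) (x : Amalg j j') :
    innerAct (inl j j' e) (inl j j' e) (extDer j j' (gaugeElt k e) hδ x) =
      extDer j j' (gaugeElt k e) hδ x := by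
  have hext := isDoubleDerivation_extDer (j' := j') hδ
  refine LinearMap.congr_fun (isDoubleDerivation_ext (hext.innerAct_comp _ _) hext fun a ↦ ?_) x
  rw [LinearMap.comp_apply, extDer_gaugeElt_inl, innerAct_innerDer, innerAct_tmul, ← map_mul, he]

end Gauge

end Amalg

section ExtensionAlgebra

variable {k : Type*} [Field k] {A : Type*} [Ring A] [Algebra k A] {e₁ e₂ : A}
  (h : IsOrthogonalPair e₁ e₂)

theorem matUnit_mul (s t p r : Fin 2) :
    matUnit k h s t * matUnit k h p r = if t = p then matUnit k h s r else 0 := by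
  split_ifs with htp
  · simp [matUnit, ← map_mul, htp]
  · simp [matUnit, ← map_mul, htp, Prod.mk_zero_zero]

theorem matUnit_mem_range (s t : Fin 2) :
    matUnit k h s t ∈ (Amalg.inr (baseToAlg k h) (baseToMat k)).range := ⟨_, rfl⟩

theorem toExt_left : toExt k h e₁ = matUnit k h 0 0 := by
  have base_eq := Amalg.inl_base (baseToAlg k h) (baseToMat k) (1, 0, 0)
  have alg_eq : baseToAlg k h (1, 0, 0) = e₁ := by simp [baseToAlg]
  have mat_eq : baseToMat k (1, 0, 0) = (Matrix.single 0 0 1, 0) := by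
    ext p q
    · fin_cases p <;> fin_cases q <;> simp [baseToMat]
    · simp [baseToMat]
  rwa [alg_eq, mat_eq] at base_eq

theorem toExt_right : toExt k h e₂ = matUnit k h 1 1 := by
  have base_eq := Amalg.inl_base (baseToAlg k h) (baseToMat k) (0, 1, 0)
  have alg_eq : baseToAlg k h (0, 1, 0) = e₂ := by simp [baseToAlg]
  have mat_eq : baseToMat k (0, 1, 0) = (Matrix.single 1 1 1, 0) := by
    ext p q
    · fin_cases p <;> fin_cases q <;> simp [baseToMat]
    · simp [baseToMat]
  rwa [alg_eq, mat_eq] at base_eq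

theorem apply_inr_eq_zero {M : Type*} [AddCommGroup M] [Module k M] (D : ExtAlg k h →ₗ[k] M)
    (h1 : D 1 = 0) (hD : ∀ s t, D (matUnit k h s t) = 0) (m : Matrix (Fin 2) (Fin 2) k × k) :
    D (Amalg.inr (baseToAlg k h) (baseToMat k) m) = 0 := by
  have hm : m = m.2 • (1 : Matrix (Fin 2) (Fin 2) k × k) +
      ((m.1 0 0 - m.2) • (Matrix.single 0 0 1, 0) + m.1 0 1 • (Matrix.single 0 1 1, 0) +
        m.1 1 0 • (Matrix.single 1 0 1, 0) + (m.1 1 1 - m.2) • (Matrix.single 1 1 1, 0)) := by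
    ext p q
    · fin_cases p <;> fin_cases q <;> simp
    · simp
  simp only [matUnit] at hD
  rw [hm]
  simp only [map_add, map_smul, map_one, h1, hD, smul_zero, add_zero]

theorem isDoubleDerivation_innerDer {Δ : ExtAlg k h ⊗[k] ExtAlg k h}
    (hΔ : ∀ s t, outerAct (matUnit k h s t) 1 Δ = outerAct 1 (matUnit k h s t) Δ) :
    IsDoubleDerivation (Amalg.inr (baseToAlg k h) (baseToMat k)).range
      (innerDer k (ExtAlg k h) Δ) where
  leibniz := innerDer_leibniz Δ
  map_base := by
    rintro _ ⟨m, rfl⟩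
    exact apply_inr_eq_zero h _ (by simp [innerDer_apply])
      (fun s t ↦ by rw [innerDer_apply, hΔ, sub_self]) m

/-- The Casimir element `e₁₁ ⊗ e₁₁ + e₂₁ ⊗ e₁₂` of the matrix units, where `e₁₁ = e₁`; it commutes
with the matrix units for the outer bimodule structure. -/
def casimir : ExtAlg k h ⊗[k] ExtAlg k h :=
  matUnit k h 0 0 ⊗ₜ matUnit k h 0 0 + matUnit k h 1 0 ⊗ₜ matUnit k h 0 1

theorem outerAct_casimir (s t : Fin 2) :
    outerAct (matUnit k h s t) 1 (casimir h) = outerAct 1 (matUnit k h s t) (casimir h) := by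
  fin_cases s <;> fin_cases t <;> simp [casimir, outerAct_tmul, matUnit_mul]

theorem contract₃_casimir :
    contract₃ (casimir h) (casimir h) (casimir h) =
      contract₃ (toExt k h e₁ ⊗ₜ toExt k h e₁) (toExt k h e₁ ⊗ₜ toExt k h e₁)
          (toExt k h e₁ ⊗ₜ toExt k h e₁) +
        contract₃ (toExt k h e₂ ⊗ₜ toExt k h e₂) (toExt k h e₂ ⊗ₜ toExt k h e₂)
          (toExt k h e₂ ⊗ₜ toExt k h e₂) +
        yangBaxter (wedge (matUnit k h 1 0) (matUnit k h 0 1)) := by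
  simp [casimir, toExt_left, toExt_right, contract₃_add_left, contract₃_add_mid,
    contract₃_add_right, contract₃_tmul, matUnit_mul, yangBaxter, wedge, TensorProduct.tmul_sub,
    TensorProduct.sub_tmul, chain_tmul, cyc_tmul]
  abel

variable (k) in
/-- The extension of the gauge element `E₁` to the extension algebra. -/
def extGauge₁ : ExtAlg k h →ₗ[k] ExtAlg k h ⊗[k] ExtAlg k h :=
  Amalg.extDer (baseToAlg k h) (baseToMat k) (gaugeElt k e₁) (isDoubleDerivation_gaugeElt₁ k h)

variable (k) in
/-- The double derivation `e₁₂ E₂ e₂₁` of the extension algebra, which moves the extension of the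
gauge element `E₂` to the corner of `e₁`. -/
def movedGauge₂ : ExtAlg k h →ₗ[k] ExtAlg k h ⊗[k] ExtAlg k h :=
  innerAct (matUnit k h 0 1) (matUnit k h 1 0) ∘ₗ
    Amalg.extDer (baseToAlg k h) (baseToMat k) (gaugeElt k e₂) (isDoubleDerivation_gaugeElt₂ k h)

theorem isDoubleDerivation_extGauge₁ :
    IsDoubleDerivation (Amalg.inr (baseToAlg k h) (baseToMat k)).range (extGauge₁ k h) :=
  Amalg.isDoubleDerivation_extDer _

theorem isDoubleDerivation_movedGauge₂ :
    IsDoubleDerivation (Amalg.inr (baseToAlg k h) (baseToMat k)).range (movedGauge₂ k h) :=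
  (Amalg.isDoubleDerivation_extDer _).innerAct_comp _ _

theorem extGauge₁_toExt (a : A) :
    extGauge₁ k h (toExt k h a) =
      innerDer k (ExtAlg k h) (matUnit k h 0 0 ⊗ₜ matUnit k h 0 0) (toExt k h a) := by
  rw [← toExt_left]
  exact Amalg.extDer_gaugeElt_inl _ a

theorem movedGauge₂_toExt (a : A) :
    movedGauge₂ k h (toExt k h a) =
      innerDer k (ExtAlg k h) (matUnit k h 1 0 ⊗ₜ matUnit k h 0 1) (toExt k h a) := by
  have innerAct_eq : innerAct (matUnit k h 0 1) (matUnit k h 1 0) (toExt k h e₂ ⊗ₜ toExt k h e₂) =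
      matUnit k h 1 0 ⊗ₜ[k] matUnit k h 0 1 := by
    simp [toExt_right, innerAct_tmul, matUnit_mul]
  rw [← innerAct_eq, ← innerAct_innerDer]
  exact congrArg _ (Amalg.extDer_gaugeElt_inl _ a)

theorem bivectorBracket_extGauge_toExt (a b : A) :
    bivectorBracket (extGauge₁ k h) (movedGauge₂ k h) (toExt k h a) (toExt k h b) =
      innerBracket k (ExtAlg k h) (wedge (matUnit k h 1 0) (matUnit k h 0 1)) (toExt k h a)
        (toExt k h b) := by
  simp only [bivectorBracket_apply, extGauge₁_toExt, movedGauge₂_toExt, contract₂_innerDer,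
    contract₂_tmul, matUnit_mul, wedge, innerBracket_sub, LinearMap.sub_apply, if_true]

/-- The extension of a double bracket to the extension algebra, corrected by the bivector
`-1/2 E₁ (e₁₂ E₂ e₂₁)`: the fused bracket is its restriction to the fusion algebra. -/
def extFusBracket (br : A →ₗ[k] A →ₗ[k] A ⊗[k] A)
    (hbr : IsDoubleBracket (baseToAlg k h).range br) :
    ExtAlg k h →ₗ[k] ExtAlg k h →ₗ[k] ExtAlg k h ⊗[k] ExtAlg k h :=
  Amalg.extBracket (baseToAlg k h) (baseToMat k) br hbr +
    (-(1 / 2) : k) • bivectorBracket (extGauge₁ k h) (movedGauge₂ k h)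

variable {br : A →ₗ[k] A →ₗ[k] A ⊗[k] A} (hbr : IsDoubleBracket (baseToAlg k h).range br)

theorem isDoubleBracket_extFusBracket :
    IsDoubleBracket (Amalg.inr (baseToAlg k h) (baseToMat k)).range (extFusBracket h br hbr) :=
  (Amalg.isDoubleBracket_extBracket hbr).add ((isDoubleBracket_bivectorBracket
    (isDoubleDerivation_extGauge₁ h) (isDoubleDerivation_movedGauge₂ h)).smul _)

theorem tripleBracket_extFusBracket_toExt (a b c : A) :
    tripleBracket (extFusBracket h br hbr) (toExt k h a) (toExt k h b) (toExt k h c) =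
      map₃ (toExt k h).toLinearMap (tripleBracket br a b c) +
        (1 / 4 : k) • innerTriple (toExt k h a) (toExt k h b) (toExt k h c)
          (yangBaxter (wedge (matUnit k h 1 0) (matUnit k h 0 1))) := by
  have extBracket_toExt (x y : A) := Amalg.extBracket_inl (j' := baseToMat k) hbr x y
  rw [map₃_tripleBracket (toExt k h).toLinearMap fun x y ↦ (extBracket_toExt x y).symm,
    show (1 / 4 : k) = (-(1 / 2)) ^ 2 by rw [neg_sq, div_pow]; norm_num]
  exact (Amalg.isDoubleBracket_extBracket hbr).tripleBracket_add_smul_of_eq_innerBracket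
    (f := (toExt k h).toLinearMap)
    (isDoubleBracket_bivectorBracket (isDoubleDerivation_extGauge₁ h)
      (isDoubleDerivation_movedGauge₂ h))
    (matUnit_mem_range h 1 0) (matUnit_mem_range h 0 1) extBracket_toExt
    (bivectorBracket_extGauge_toExt h) _ a b c

end ExtensionAlgebra

/-! ### Corners and fusion algebras -/

section Corner

variable {k : Type*} [Field k] {R : Type*} [Ring R] [Algebra k R] {ε : R}

theorem cornerIncl_mul (hε : IsIdempotentElem ε) (x y : hε.Corner) :
    cornerIncl k hε (x * y) = cornerIncl k hε x * cornerIncl k hε y := rfl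

theorem cornerIncl_cornerProj (hε : IsIdempotentElem ε) (x : R) :
    cornerIncl k hε (cornerProj k hε x) = ε * x * ε := rfl

theorem mul_cornerIncl (hε : IsIdempotentElem ε) (x : hε.Corner) :
    ε * cornerIncl k hε x = cornerIncl k hε x := by
  obtain ⟨_, r, rfl⟩ := x
  change ε * (ε * r * ε) = ε * r * ε
  simp only [← mul_assoc, hε.eq]

theorem cornerIncl_mul_self (hε : IsIdempotentElem ε) (x : hε.Corner) :
    cornerIncl k hε x * ε = cornerIncl k hε x := by
  obtain ⟨_, r, rfl⟩ := x
  change ε * r * ε * ε = ε * r * ε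
  rw [mul_assoc, hε.eq]

theorem cornerIncl_injective (hε : IsIdempotentElem ε) :
    Function.Injective (cornerIncl k hε) := Subtype.val_injective

theorem cornerProj_cornerIncl (hε : IsIdempotentElem ε) (x : hε.Corner) :
    cornerProj k hε (cornerIncl k hε x) = x :=
  cornerIncl_injective (k := k) hε (by
    rw [cornerIncl_cornerProj, mul_cornerIncl, cornerIncl_mul_self])

theorem cornerProj_comp_cornerIncl (hε : IsIdempotentElem ε) :
    cornerProj k hε ∘ₗ cornerIncl k hε = LinearMap.id :=
  LinearMap.ext (cornerProj_cornerIncl hε)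

theorem map_cornerIncl_injective (hε : IsIdempotentElem ε) :
    Function.Injective (TensorProduct.map (cornerIncl k hε) (cornerIncl k hε)) := by
  refine Function.LeftInverse.injective
    (g := TensorProduct.map (cornerProj k hε) (cornerProj k hε)) fun t ↦ ?_
  rw [← LinearMap.comp_apply, ← TensorProduct.map_comp, cornerProj_comp_cornerIncl,
    TensorProduct.map_id, LinearMap.id_apply]

theorem map₃_cornerIncl_injective (hε : IsIdempotentElem ε) :
    Function.Injective (map₃ (cornerIncl k hε)) := by
  refine Function.LeftInverse.injective (g := TensorProduct.map
    (TensorProduct.map (cornerProj k hε) (cornerProj k hε)) (cornerProj k hε)) fun t ↦ ?_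
  rw [map₃, ← LinearMap.comp_apply, ← TensorProduct.map_comp, ← TensorProduct.map_comp,
    cornerProj_comp_cornerIncl, TensorProduct.map_id, TensorProduct.map_id, LinearMap.id_apply]

theorem map_cornerIncl_map_cornerProj (hε : IsIdempotentElem ε) (t : R ⊗[k] R) :
    TensorProduct.map (cornerIncl k hε) (cornerIncl k hε)
      (TensorProduct.map (cornerProj k hε) (cornerProj k hε) t) =
    innerAct ε ε (outerAct ε ε t) := by
  induction t with
  | zero => simp
  | add u v hu hv => simp only [map_add, hu, hv]
  | tmul x y =>
    simp only [TensorProduct.map_tmul, cornerIncl_cornerProj, innerAct_tmul, outerAct_tmul,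
      mul_assoc]

variable {B : Subalgebra k R}

theorem IsDoubleDerivation.outerAct_corner (hε : IsIdempotentElem ε) (hB : ε ∈ B)
    {δ : R →ₗ[k] R ⊗[k] R} (hδ : IsDoubleDerivation B δ) (x : hε.Corner) :
    outerAct ε ε (δ (cornerIncl k hε x)) = δ (cornerIncl k hε x) := by
  conv_rhs => rw [← mul_cornerIncl hε x, ← cornerIncl_mul_self hε x]
  simp only [hδ.leibniz, hδ.map_base ε hB, map_zero, zero_add, add_zero, ← outerAct_mul, mul_one]

theorem map_cornerIncl_cornerDer (hε : IsIdempotentElem ε) (hB : ε ∈ B) (q p : R)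
    {δ : R →ₗ[k] R ⊗[k] R} (hδ : IsDoubleDerivation B δ) (x : hε.Corner) :
    TensorProduct.map (cornerIncl k hε) (cornerIncl k hε) (cornerDer hε q p δ x) =
      innerAct (ε * q) (p * ε) (δ (cornerIncl k hε x)) := by
  simp only [cornerDer, LinearMap.comp_apply, map_cornerIncl_map_cornerProj, outerAct_innerAct,
    hδ.outerAct_corner hε hB, innerAct_mul]

theorem map_cornerIncl_cornerBracket (hε : IsIdempotentElem ε) (hB : ε ∈ B)
    {br : R →ₗ[k] R →ₗ[k] R ⊗[k] R} (hbr : IsDoubleBracket B br) (x y : hε.Corner) :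
    TensorProduct.map (cornerIncl k hε) (cornerIncl k hε) (cornerBracket hε br x y) =
      br (cornerIncl k hε x) (cornerIncl k hε y) := by
  change TensorProduct.map _ _ (TensorProduct.map (cornerProj k hε) (cornerProj k hε)
    (br (cornerIncl k hε x) (cornerIncl k hε y))) = _
  rw [map_cornerIncl_map_cornerProj]
  conv_rhs => rw [← mul_cornerIncl hε x, ← cornerIncl_mul_self hε x,
    ← mul_cornerIncl hε y, ← cornerIncl_mul_self hε y]
  simp only [hbr.leibniz, hbr.leibniz_left, hbr.base_right _ ε hB, hbr.base_left ε hB, map_zero,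
    zero_add, add_zero, outerAct_innerAct, ← outerAct_mul, ← innerAct_mul, mul_one]

end Corner

section Fusion

variable {k : Type*} [Field k] {A : Type*} [Ring A] [Algebra k A] {e₁ e₂ : A}
  (h : IsOrthogonalPair e₁ e₂)

variable (k) in
/-- The inclusion of the fusion algebra into the extension algebra. -/
abbrev fusIncl : FusAlg k h →ₗ[k] ExtAlg k h := cornerIncl k (isIdempotentElem_eps k h)

theorem eps_mem_range :
    1 - toExt k h e₂ ∈ (Amalg.inr (baseToAlg k h) (baseToMat k)).range := by
  rw [toExt_right]
  exact sub_mem (one_mem _) (matUnit_mem_range h 1 1)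

theorem eps_mul_matUnit (s t : Fin 2) :
    (1 - toExt k h e₂) * matUnit k h s t = if s = 0 then matUnit k h s t else 0 := by
  fin_cases s <;> simp [toExt_right, sub_mul, matUnit_mul]

theorem matUnit_mul_eps (s t : Fin 2) :
    matUnit k h s t * (1 - toExt k h e₂) = if t = 0 then matUnit k h s t else 0 := by
  fin_cases t <;> simp [toExt_right, mul_sub, matUnit_mul]

theorem map_fusIncl_trDer {δ : A →ₗ[k] A ⊗[k] A}
    (hδ : IsDoubleDerivation (baseToAlg k h).range δ) (x : FusAlg k h) :
    TensorProduct.map (fusIncl k h) (fusIncl k h) (trDer h δ hδ x) =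
      innerAct (1 - toExt k h e₂) (1 - toExt k h e₂)
          (Amalg.extDer (baseToAlg k h) (baseToMat k) δ hδ (fusIncl k h x)) +
        innerAct (matUnit k h 0 1) (matUnit k h 1 0)
          (Amalg.extDer (baseToAlg k h) (baseToMat k) δ hδ (fusIncl k h x)) := by
  have map_cornerDer (q p : ExtAlg k h) := map_cornerIncl_cornerDer (isIdempotentElem_eps k h)
    (eps_mem_range h) q p (Amalg.isDoubleDerivation_extDer hδ) x
  rw [trDer, LinearMap.add_apply, map_add, map_cornerDer, map_cornerDer, mul_one, one_mul,
    eps_mul_matUnit, matUnit_mul_eps, if_pos rfl, if_pos rfl]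

theorem map_fusIncl_trDer_gaugeElt₁ (x : FusAlg k h) :
    TensorProduct.map (fusIncl k h) (fusIncl k h)
      (trDer h (gaugeElt k e₁) (isDoubleDerivation_gaugeElt₁ k h) x) =
      extGauge₁ k h (fusIncl k h x) := by
  have innerAct_extGauge₁ : innerAct (matUnit k h 0 0) (matUnit k h 0 0)
      (extGauge₁ k h (fusIncl k h x)) = extGauge₁ k h (fusIncl k h x) := by
    rw [← toExt_left]
    exact Amalg.innerAct_extDer_gaugeElt _ h.idem₁ _
  rw [map_fusIncl_trDer, ← extGauge₁, ← innerAct_extGauge₁]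
  simp [← innerAct_mul, eps_mul_matUnit, matUnit_mul_eps, matUnit_mul, innerAct_zero_left]

theorem map_fusIncl_trDer_gaugeElt₂ (x : FusAlg k h) :
    TensorProduct.map (fusIncl k h) (fusIncl k h)
      (trDer h (gaugeElt k e₂) (isDoubleDerivation_gaugeElt₂ k h) x) =
      movedGauge₂ k h (fusIncl k h x) := by
  have innerAct_extDer := Amalg.innerAct_extDer_gaugeElt (j' := baseToMat k)
    (isDoubleDerivation_gaugeElt₂ k h) h.idem₂ (fusIncl k h x)
  rw [show Amalg.inl (baseToAlg k h) (baseToMat k) e₂ = _ from toExt_right h] at innerAct_extDer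
  rw [map_fusIncl_trDer, movedGauge₂, LinearMap.comp_apply, add_eq_right, ← innerAct_extDer,
    ← innerAct_mul, eps_mul_matUnit, if_neg one_ne_zero, innerAct_zero_left]

theorem map_fusIncl_bracket {br : A →ₗ[k] A →ₗ[k] A ⊗[k] A}
    (hbr : IsDoubleBracket (baseToAlg k h).range br) (x y : FusAlg k h) :
    TensorProduct.map (fusIncl k h) (fusIncl k h)
      ((inducedBracket h br hbr + fusBracket k h) x y) =
      extFusBracket h br hbr (fusIncl k h x) (fusIncl k h y) := by
  simp only [extFusBracket, fusBracket, inducedBracket, LinearMap.add_apply, map_add,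
    LinearMap.smul_apply, map_smul, bivectorBracket_apply, map_sub]
  rw [map_cornerIncl_cornerBracket _ (eps_mem_range h) (Amalg.isDoubleBracket_extBracket hbr),
    map_contract₂ _ (cornerIncl_mul _), map_contract₂ _ (cornerIncl_mul _),
    map_fusIncl_trDer_gaugeElt₁, map_fusIncl_trDer_gaugeElt₁, map_fusIncl_trDer_gaugeElt₂,
    map_fusIncl_trDer_gaugeElt₂]

theorem fusIncl_toFus {a : A} (h₂ : a * e₂ = 0) (h₂' : e₂ * a = 0) :
    fusIncl k h (toFus k h a) = toExt k h a := by
  change (1 - toExt k h e₂) * toExt k h a * (1 - toExt k h e₂) = _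
  simp [sub_mul, mul_sub, ← map_mul, h₂, h₂']

theorem innerDer_casimir_fusIncl (x : FusAlg k h) :
    innerDer k (ExtAlg k h) (casimir h) (fusIncl k h x) =
      gaugeElt k (toExt k h e₁) (fusIncl k h x) := by
  have mul_matUnit : fusIncl k h x * matUnit k h 1 0 = 0 := by
    rw [← cornerIncl_mul_self, mul_assoc, eps_mul_matUnit, if_neg one_ne_zero, mul_zero]
  have matUnit_mul : matUnit k h 0 1 * fusIncl k h x = 0 := by
    rw [← mul_cornerIncl, ← mul_assoc, matUnit_mul_eps, if_neg one_ne_zero, zero_mul]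
  rw [← innerDer_tmul_self, toExt_left]
  simp [casimir, innerDer_apply, outerAct_tmul, mul_matUnit, matUnit_mul]

theorem trivectorBracket_innerDer_casimir (x y z : ExtAlg k h) :
    trivectorBracket (innerDer k (ExtAlg k h) (casimir h)) (innerDer k (ExtAlg k h) (casimir h))
        (innerDer k (ExtAlg k h) (casimir h)) x y z =
      trivectorBracket (gaugeElt k (toExt k h e₁)) (gaugeElt k (toExt k h e₁))
          (gaugeElt k (toExt k h e₁)) x y z +
        trivectorBracket (gaugeElt k (toExt k h e₂)) (gaugeElt k (toExt k h e₂))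
          (gaugeElt k (toExt k h e₂)) x y z +
        (3 : k) • innerTriple x y z
          (yangBaxter (wedge (matUnit k h 1 0) (matUnit k h 0 1))) := by
  simp only [← innerDer_tmul_self, trivectorBracket_innerDer, contract₃_casimir, map_add, smul_add]

theorem matUnit_mul_toExt {a : A} (h₁ : e₁ * a = 0) (h₂ : e₂ * a = 0) (s t : Fin 2) :
    matUnit k h s t * toExt k h a = 0 := by
  have diag : matUnit k h t t * toExt k h a = 0 := by
    fin_cases t
    · simpa [h₁, toExt_left] using (map_mul (toExt k h) e₁ a).symm
    · simpa [h₂, toExt_right] using (map_mul (toExt k h) e₂ a).symm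
  have mul_diag : matUnit k h s t = matUnit k h s t * matUnit k h t t := by
    rw [matUnit_mul, if_pos rfl]
  rw [mul_diag, mul_assoc, diag, mul_zero]

theorem toExt_mul_matUnit {a : A} (h₁ : a * e₁ = 0) (h₂ : a * e₂ = 0) (s t : Fin 2) :
    toExt k h a * matUnit k h s t = 0 := by
  have diag : toExt k h a * matUnit k h s s = 0 := by
    fin_cases s
    · simpa [h₁, toExt_left] using (map_mul (toExt k h) a e₁).symm
    · simpa [h₂, toExt_right] using (map_mul (toExt k h) a e₂).symm
  have diag_mul : matUnit k h s t = matUnit k h s s * matUnit k h s t := by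
    rw [matUnit_mul, if_pos rfl]
  rw [diag_mul, ← mul_assoc, diag, zero_mul]

end Fusion

section FusionOfIdempotents

theorem sum_subtype_ne_update_add {I M : Type*} [Fintype I] [DecidableEq I] [AddCommGroup M]
    {i j : I} (hij : i ≠ j) (g : I → M) (m : M) :
    ∑ s : {s : I // s ≠ j}, Function.update g i (g i + g j + m) s = ∑ s, g s + m := by
  have sum_update := Finset.sum_update_of_mem (Finset.mem_univ i) g (g i + g j + m)
  have sum_eq := Finset.sum_update_of_mem (Finset.mem_univ i) g (g i)
  rw [Function.update_eq_self] at sum_eq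
  rw [Fintype.sum_eq_add_sum_subtype_ne _ j, Function.update_of_ne hij.symm] at sum_update
  rw [sum_eq, ← sub_eq_zero, ← sub_eq_zero.mpr sum_update]
  abel

variable {k : Type*} [Field k] {A : Type*} [Ring A] [Algebra k A] {I : Type*} [Fintype I]
  {e : I → A} {i j : I}

theorem gaugeElt_apply_idempotent (he : CompleteOrthogonalIdempotents e) (s t : I) :
    gaugeElt k (e s) (e t) = 0 := by
  rcases eq_or_ne s t with rfl | hst
  · simp [gaugeElt, (he.idem s).eq]
  · simp [gaugeElt, he.ortho hst, he.ortho hst.symm]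

theorem completeOrthogonalIdempotents_toFus [DecidableEq I] (he : CompleteOrthogonalIdempotents e)
    (hij : i ≠ j) : CompleteOrthogonalIdempotents
      (fun s : {s : I // s ≠ j} ↦ toFus k (he.isOrthogonalPair hij) (e s)) := by
  set h := he.isOrthogonalPair hij
  have fusIncl_toFus_coe (s : {s : I // s ≠ j}) := fusIncl_toFus (k := k) h (he.ortho s.2)
    (he.ortho s.2.symm)
  have fusIncl_injective := cornerIncl_injective (k := k) (isIdempotentElem_eps k h)
  refine ⟨⟨fun s ↦ fusIncl_injective ?idem, fun s t hst ↦ fusIncl_injective ?ortho⟩,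
    fusIncl_injective ?complete⟩
  case idem => rw [cornerIncl_mul, fusIncl_toFus_coe, ← map_mul, he.idem s]
  case ortho =>
    rw [cornerIncl_mul, fusIncl_toFus_coe, fusIncl_toFus_coe, ← map_mul,
      he.ortho (Subtype.coe_ne_coe.mpr hst), map_zero, map_zero]
  case complete =>
    have sum_eq : ∑ s : {s // s ≠ j}, e s = 1 - e j := by
      rw [← he.complete, Fintype.sum_eq_add_sum_subtype_ne e j, add_sub_cancel_left]
    simp only [map_sum, fusIncl_toFus_coe]
    rw [← map_sum, sum_eq, map_sub, map_one]
    rfl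

theorem extFusBracket_toExt_idempotent (h : IsOrthogonalPair (e i) (e j))
    {br : A →ₗ[k] A →ₗ[k] A ⊗[k] A} (hqp : IsDoubleQuasiPoisson e br)
    (hbr : IsDoubleBracket (baseToAlg k h).range br) (x : ExtAlg k h) (s : I) :
    extFusBracket h br hbr x (toExt k h (e s)) = 0 := by
  refine Amalg.apply_inl_eq_zero (isDoubleBracket_extFusBracket h hbr) (fun a ↦ ?_) x
  have extBracket_eq := Amalg.extBracket_inl (j' := baseToMat k) hbr (e s) a
  rw [hqp.bracket.base_left _ (Algebra.subset_adjoin ⟨s, rfl⟩), map_zero] at extBracket_eq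
  have extGauge₁_eq : extGauge₁ k h (toExt k h (e s)) = 0 :=
    (Amalg.extDer_inl _ _).trans (by rw [gaugeElt_apply_idempotent hqp.idem, map_zero])
  have movedGauge₂_eq : movedGauge₂ k h (toExt k h (e s)) = 0 := by
    rw [movedGauge₂, LinearMap.comp_apply, toExt, Amalg.extDer_inl,
      gaugeElt_apply_idempotent hqp.idem, map_zero, map_zero]
  rw [← toExt] at extBracket_eq ⊢
  simp only [extFusBracket, LinearMap.add_apply, LinearMap.smul_apply, bivectorBracket_apply,
    extBracket_eq, extGauge₁_eq, movedGauge₂_eq, map_zero, LinearMap.zero_apply, sub_zero,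
    smul_zero, add_zero]

variable [DecidableEq I] (h : IsOrthogonalPair (e i) (e j))

variable (k) in
/-- The elements of the tensor square of the extension algebra whose inner double derivations
restrict to the gauge elements of the fusion algebra: `e_s ⊗ e_s` for `s ≠ i`, and the Casimir
element for `s = i`. -/
def fusTensor : I → ExtAlg k h ⊗[k] ExtAlg k h :=
  Function.update (fun s ↦ toExt k h (e s) ⊗ₜ toExt k h (e s)) i (casimir h)

theorem isDoubleDerivation_innerDer_fusTensor (he : CompleteOrthogonalIdempotents e) {s : I}
    (hs : s ≠ j) : IsDoubleDerivation (Amalg.inr (baseToAlg k h) (baseToMat k)).range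
      (innerDer k (ExtAlg k h) (fusTensor k h s)) := by
  refine isDoubleDerivation_innerDer h fun p q ↦ ?_
  rcases eq_or_ne s i with rfl | hsi
  · simpa only [fusTensor, Function.update_self] using outerAct_casimir h p q
  · rw [fusTensor, Function.update_of_ne hsi, outerAct_tmul, outerAct_tmul,
      matUnit_mul_toExt h (he.ortho hsi.symm) (he.ortho hs.symm),
      toExt_mul_matUnit h (he.ortho hsi) (he.ortho hs), TensorProduct.zero_tmul,
      TensorProduct.tmul_zero]

theorem sum_trivectorBracket_fusTensor (hij : i ≠ j) (x y z : ExtAlg k h) :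
    ∑ s : {s : I // s ≠ j}, trivectorBracket (innerDer k (ExtAlg k h) (fusTensor k h s))
        (innerDer k (ExtAlg k h) (fusTensor k h s)) (innerDer k (ExtAlg k h) (fusTensor k h s))
        x y z =
      ∑ s, trivectorBracket (gaugeElt k (toExt k h (e s))) (gaugeElt k (toExt k h (e s)))
          (gaugeElt k (toExt k h (e s))) x y z +
        (3 : k) • innerTriple x y z
          (yangBaxter (wedge (matUnit k h 1 0) (matUnit k h 0 1))) := by
  rw [← sum_subtype_ne_update_add hij, ← trivectorBracket_innerDer_casimir]
  refine Finset.sum_congr rfl fun s _ ↦ ?_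
  rw [fusTensor]
  rcases eq_or_ne s.1 i with hsi | hsi
  · rw [hsi, Function.update_self, Function.update_self]
  · rw [Function.update_of_ne hsi, Function.update_of_ne hsi, innerDer_tmul_self]

theorem tripleBracket_extFusBracket (h3 : (3 : k) ≠ 0) {br : A →ₗ[k] A →ₗ[k] A ⊗[k] A}
    (hqp : IsDoubleQuasiPoisson e br) (hij : i ≠ j)
    (hbr : IsDoubleBracket (baseToAlg k h).range br) (x y z : ExtAlg k h) :
    tripleBracket (extFusBracket h br hbr) x y z =
      (1 / 12 : k) • ∑ s : {s : I // s ≠ j},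
        trivectorBracket (innerDer k (ExtAlg k h) (fusTensor k h s))
          (innerDer k (ExtAlg k h) (fusTensor k h s)) (innerDer k (ExtAlg k h) (fusTensor k h s))
          x y z := by
  refine Amalg.isTripleDerivation_ext (isDoubleBracket_extFusBracket h hbr).isTripleDerivation
    ((IsTripleDerivation.sum fun s : {s : I // s ≠ j} ↦ ?_).smul (1 / 12 : k))
    (fun a b c ↦ ?_) x y z
  · have := isDoubleDerivation_innerDer_fusTensor (k := k) h hqp.idem s.2
    exact isTripleDerivation_trivectorBracket this this this
  · have map₃_gaugeElt (s : I) := map₃_trivectorBracket (toExt k h).toLinearMap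
      (map_mul (toExt k h)) (map_gaugeElt (toExt k h).toLinearMap (map_mul (toExt k h)) (e s)) a b c
    have one_twelfth_mul_three : (1 / 12 : k) * 3 = 1 / 4 := by
      rw [show (12 : k) = 4 * 3 by norm_num]; field_simp
    change tripleBracket (extFusBracket h br hbr) (toExt k h a) (toExt k h b) (toExt k h c) = _
    rw [tripleBracket_extFusBracket_toExt, hqp.quasiPoisson, map_smul, map_sum]
    simp only [map₃_gaugeElt]
    rw [sum_trivectorBracket_fusTensor h hij, smul_add, smul_smul, one_twelfth_mul_three]
    rfl

theorem map_fusIncl_gaugeElt (he : CompleteOrthogonalIdempotents e) {s : I} (hs : s ≠ j)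
    (x : FusAlg k h) :
    TensorProduct.map (fusIncl k h) (fusIncl k h) (gaugeElt k (toFus k h (e s)) x) =
      innerDer k (ExtAlg k h) (fusTensor k h s) (fusIncl k h x) := by
  rw [map_gaugeElt _ (cornerIncl_mul _), fusIncl_toFus h (he.ortho hs) (he.ortho hs.symm),
    fusTensor]
  rcases eq_or_ne s i with rfl | hsi
  · rw [Function.update_self, innerDer_casimir_fusIncl]
  · rw [Function.update_of_ne hsi, innerDer_tmul_self]

end FusionOfIdempotents

end DoubleBrackets

end

open DoubleBrackets in
theorem theorem2_general {k : Type*} [Field k] (h6 : (6 : k) ≠ 0) {A : Type*} [Ring A] [Algebra k A]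
    {I : Type*} [Fintype I] [DecidableEq I] (e : I → A)
    (br : A →ₗ[k] A →ₗ[k] TensorProduct k A A) (h : IsDoubleQuasiPoisson e br) (i j : I)
    (hij : i ≠ j) :
    IsDoubleQuasiPoisson
      (fun s : {s : I // s ≠ j} ↦ toFus k (h.idem.isOrthogonalPair hij) (e s))
      (inducedBracket (h.idem.isOrthogonalPair hij) br (h.isDoubleBracket_base hij) +
        fusBracket k (h.idem.isOrthogonalPair hij)) := by
  have h3 : (3 : k) ≠ 0 := fun h3 ↦ h6 (by rw [show (6 : k) = 2 * 3 by norm_num, h3, mul_zero])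
  have pair := h.idem.isOrthogonalPair hij
  have hbr := h.isDoubleBracket_base hij
  refine ⟨completeOrthogonalIdempotents_toFus h.idem hij, ?bracket, fun x y z ↦ ?quasiPoisson⟩
  case bracket =>
    refine isDoubleBracket_adjoin_of_injective (fusIncl k pair) (cornerIncl_mul _)
      (map_cornerIncl_injective _) (isDoubleBracket_extFusBracket pair hbr)
      (map_fusIncl_bracket pair hbr) ?_
    rintro x _ ⟨s, rfl⟩
    rw [fusIncl_toFus pair (h.idem.ortho s.2) (h.idem.ortho s.2.symm),
      extFusBracket_toExt_idempotent pair h]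
  case quasiPoisson =>
    have map₃_gaugeElt (s : {s : I // s ≠ j}) := map₃_trivectorBracket (fusIncl k pair)
      (cornerIncl_mul _) (map_fusIncl_gaugeElt pair h.idem s.2) x y z
    refine map₃_cornerIncl_injective (isIdempotentElem_eps k pair) ?_
    rw [map₃_tripleBracket _ (map_fusIncl_bracket pair hbr),
      tripleBracket_extFusBracket pair h3 h hij, map_smul, map_sum]
    simp only [map₃_gaugeElt]

/-- If `A` is a double quasi-Poisson algebra over `B = ⨁ k e_s`, then the algebra obtained by fusing
`e_j` onto `e_i` is a double quasi-Poisson algebra over `B^f = ⨁_{s ≠ j} k e_s` for the sum of the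
induced double bracket and of the double bracket defined by `-1/2 Tr(E_i) Tr(E_j)`. -/
theorem theorem2 {k : Type*} [Field k] [CharZero k] {A : Type*} [Ring A] [Algebra k A]
    {I : Type*} [Fintype I] [DecidableEq I] (e : I → A)
    (br : A →ₗ[k] A →ₗ[k] TensorProduct k A A)
    (h : DoubleBrackets.IsDoubleQuasiPoisson e br) (i j : I) (hij : i ≠ j) :
    DoubleBrackets.IsDoubleQuasiPoisson
      (fun s : {s : I // s ≠ j} ↦
        DoubleBrackets.toFus k (h.idem.isOrthogonalPair hij) (e s))
      (DoubleBrackets.inducedBracket (h.idem.isOrthogonalPair hij) br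
          (h.isDoubleBracket_base hij) +
        DoubleBrackets.fusBracket k (h.idem.isOrthogonalPair hij)) :=
  theorem2_general (by norm_num) e br h i j hij
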